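/- Let $G$ be a $\sigma$-compact, locally compact, Hausdorff, étale, ample groupoid with compact unit space $G^{(0)}$, source map $s$ and range map $r$. For sets $A,K\subseteq G$ and $u\in G^{(0)}$ write $KA=\{yx: y\in K, x\in A, s(y)=r(x)\}$, $Au=\{x\in A: s(x)=u\}$ and $\partial_K A=(KA\setminus A)\cup\{x\in A: yx\notin A\text{ for some }y\in K\text{ with }s(y)=r(x)\}$. Let $M(G)$ be the set of Borel probability measures $\mu$ on $G^{(0)}$ with $\mu(s(U))=\mu(r(U))$ for every open bisection $U$. *Normal Følner sets.* A multisection is a finite family $\{C_{i,j}: i,j\in F\}$ of bisections such that $C_{i,j}C_{j,k}=C_{i,k}$ for all $i,j,k\in F$ and the $C_{i,i}$ are pairwise disjoint subsets of $G^{(0)}$. For a compact set $K\subseteq G$ and $\epsilon>0$, a normal $(K,\epsilon)$-Følner set is a set $S=\bigcup_{l=1}^m\bigsqcup_{i\in F_l}C^l_{i,i_l}$, given with compact open multisections $\{C^l_{i,j}: i,j\in F_l\}$ ($1\le l\le m$) and indices $i_l\in F_l$ with $G^{(0)}=\bigsqcup_{l=1}^m C^l_{i_l,i_l}$, such that $|\partial_K(Su)|\le\epsilon|Su|$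 for all $u\in G^{(0)}$; $S$ is a normal Følner set if it is so for some compact $K$ and some $\epsilon>0$. A Følner sequence is a sequence $(S_n)_{n\in\mathbb N}$ of normal Følner sets such that $|KS_nu\setminus S_nu|/|S_nu|\to0$ as $n\to\infty$ for every compact $K\subseteq G$ and every $u\in G^{(0)}$. *Height and goodness.* The height of such an $S$ is $h(S)=\min_l|F_l|$; $S$ has $1$-controlled height if $|F_l|\le h(S)$ for all $l$. For $M\in\mathbb N_{+}$ and $\epsilon>0$, $S$ is $(M,\epsilon)$-good if there are injections $f_l:\{0,\dots,h(S)-1\}\to F_l$ ($1\le l\le m$) such that 1. $f_l(0)=i_l$ for all $l$; 2. $\inf_{\mu\in M(G)}\mu\big(\bigcup_{l=1}^m C^l_{f_l(k),f_l(k)}\big)\ge1-\epsilon$ for all $0\le k\le h(S)-1$; 3. there is $L\subseteq\{1,\dots,m\}$ with $\inf_{\mu\in M(G)}\mu\big(\bigsqcup_{l\in L}C^l_{i_l,i_l}\big)>1-\epsilon$ such that, for every $0\le k\le h(S)-1$, the indexed family $\{C^l_{f_l(k),f_l(k)}\}_{l\in L}$ can be split into at most $M$ subfamilies, each consisting of pairwise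 disjoint sets. **Theorem A.** Let $M\in\mathbb N_{+}$ and let $(\epsilon_n)_{n\in\mathbb N}$ be a decreasing sequence of positive numbers with $\epsilon_n\to0$. Suppose that $G$ has a Følner sequence $(S_n)_{n\in\mathbb N}$ in which every $S_n$ is $(M,\epsilon_n)$-good and has $1$-controlled height. Then $G$ is almost finite in measure: for every compact $K\subseteq G$ and every $\epsilon>0$ there is a compact open elementary (that is, principal) subgroupoid $H\subseteq G$ such that $|KHu\setminus Hu|<\epsilon|Hu|$ for every $u\in H^{(0)}$, and $\mu(H^{(0)})>1-\epsilon$ for every $\mu\in M(G)$. -/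

import Mathlib

open Filter Topology MeasureTheory

/-- A groupoid, presented by its set `G` of arrows, with source, range, inverse and a partial
product. The units are the arrows of the form `s x`, and `s x = x⁻¹ x`, `r x = x x⁻¹`. -/
class ArrowGroupoid (G : Type*) where
  /-- source -/
  s : G → G
  /-- range -/
  r : G → G
  /-- inverse -/
  inv : G → G
  /-- the product `x y`, defined when the source of `x` is the range of `y` -/
  comp : ∀ x y : G, s x = r y → G
  s_s : ∀ x, s (s x) = s x
  r_s : ∀ x, r (s x) = s x
  s_r : ∀ x, s (r x) = r x
  r_r : ∀ x, r (r x) = r x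
  s_comp : ∀ x y h, s (comp x y h) = s y
  r_comp : ∀ x y h, r (comp x y h) = r x
  comp_assoc : ∀ (x y z : G) (hxy : s x = r y) (hyz : s y = r z)
    (h₁ : s (comp x y hxy) = r z) (h₂ : s x = r (comp y z hyz)),
    comp (comp x y hxy) z h₁ = comp x (comp y z hyz) h₂
  comp_unit : ∀ x (h : s x = r (s x)), comp x (s x) h = x
  unit_comp : ∀ x (h : s (r x) = r x), comp (r x) x h = x
  s_inv : ∀ x, s (inv x) = r x
  r_inv : ∀ x, r (inv x) = s x
  comp_inv : ∀ x (h : s x = r (inv x)), comp x (inv x) h = r x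
  inv_comp : ∀ x (h : s (inv x) = r x), comp (inv x) x h = s x

namespace ArrowGroupoid

section Algebra

variable {G : Type*} [ArrowGroupoid G]

/-- The product `A B` of two sets of arrows. -/
def setMul (A B : Set G) : Set G :=
  {z | ∃ x ∈ A, ∃ y ∈ B, ∃ h : s x = r y, comp x y h = z}

/-- `A u`, the part of `A` in the source fiber over `u`. -/
def fiber (A : Set G) (u : G) : Set G := {x | x ∈ A ∧ s x = u}

/-- The left outer `K`-boundary `K A \ A`. -/
def outerBoundary (K A : Set G) : Set G := setMul K A \ A

/-- The left inner `K`-boundary of `A`: those `x ∈ A` with `y x ∉ A` for some `y ∈ K`. -/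
def innerBoundary (K A : Set G) : Set G :=
  {x | x ∈ A ∧ ∃ y ∈ K, ∃ h : s y = r x, comp y x h ∉ A}

/-- The left `K`-boundary. -/
def boundary (K A : Set G) : Set G := outerBoundary K A ∪ innerBoundary K A

/-- `F` is a `(K, ε)`-Følner set: finite, non-empty, with `|∂_K F| / |F| ≤ ε`. -/
def IsFolner (K : Set G) (ε : ℝ) (F : Set G) : Prop :=
  F.Finite ∧ F.Nonempty ∧ (boundary K F).Finite ∧
    ((boundary K F).ncard : ℝ) / (F.ncard : ℝ) ≤ ε

variable (G) in
/-- The unit space. -/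
def units : Set G := Set.range (s : G → G)

end Algebra

section Topology

variable {G : Type*} [TopologicalSpace G] [ArrowGroupoid G]

/-- `B` is contained in an open set `U` on which source and range are homeomorphisms onto open
sets. -/
def IsBisection (B : Set G) : Prop :=
  ∃ U : Set G, IsOpen U ∧ B ⊆ U ∧
    IsOpenEmbedding (U.domRestrict (s : G → G)) ∧ IsOpenEmbedding (U.domRestrict (r : G → G))

variable (G) in
/-- An ample groupoid: a topological groupoid that is étale and has a basis of compact open
bisections. (Hausdorffness and local compactness are stated separately.) -/
class IsAmple : Prop where
  continuous_inv : Continuous (inv : G → G)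
  continuous_comp :
    Continuous (fun p : {p : G × G // s p.1 = r p.2} => comp p.1.1 p.1.2 p.2)
  etale : IsLocalHomeomorph (r : G → G)
  basis : TopologicalSpace.IsTopologicalBasis
    {B : Set G | IsCompact B ∧ IsOpen B ∧ IsBisection B}

/-- A multisection, indexed by `ι`. -/
structure IsMultisection {ι : Type*} (C : ι → ι → Set G) : Prop where
  bisection : ∀ i j, IsBisection (C i j)
  mul : ∀ i j k, setMul (C i j) (C j k) = C i k
  level_subset : ∀ i, C i i ⊆ units G
  level_disjoint : ∀ i j, i ≠ j → Disjoint (C i i) (C j j)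

variable (G) in
/-- A finite family `C^l_{i,j}` (`l < m`, `i, j ∈ F_l`, with `F_l = {0, …, size l - 1}`) of
compact open multisections with chosen indices `i_l = base l`, such that the levels
`C^l_{i_l, i_l}` partition the unit space. -/
structure TowerSystem where
  m : ℕ
  size : Fin m → ℕ
  C : ∀ l : Fin m, Fin (size l) → Fin (size l) → Set G
  base : ∀ l : Fin m, Fin (size l)
  multisection : ∀ l, IsMultisection (C l)
  isCompact : ∀ l i j, IsCompact (C l i j)
  isOpen : ∀ l i j, IsOpen (C l i j)
  iUnion_base : ⋃ l, C l (base l) (base l) = units G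
  base_disjoint : ∀ l l', l ≠ l' →
    Disjoint (C l (base l) (base l)) (C l' (base l') (base l'))

/-- The set `S = ⋃ l, ⋃ i, C^l_{i, i_l}` given by the family. -/
def TowerSystem.carrier (T : TowerSystem G) : Set G :=
  ⋃ l, ⋃ i, T.C l i (T.base l)

/-- The set `S` given by the family is a normal `(K, ε)`-Følner set. -/
def TowerSystem.IsNormalFolner (T : TowerSystem G) (K : Set G) (ε : ℝ) : Prop :=
  ∀ u ∈ units G, IsFolner K ε (fiber T.carrier u)

/-- The height `min_l |F_l|`. -/
noncomputable def TowerSystem.height (T : TowerSystem G) : ℕ := ⨅ l, T.size l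

/-- `N`-controlled height. -/
def TowerSystem.HasControlledHeight (T : TowerSystem G) (N : ℕ) : Prop :=
  ∀ l, T.size l ≤ N * T.height

/-- A Følner sequence: a sequence of normal Følner sets `S n`, each given with its family of
multisections, such that `|K S_n u \ S_n u| / |S_n u| → 0` for all compact `K` and all units `u`. -/
def IsFolnerSequence (S : ℕ → TowerSystem G) : Prop :=
  (∀ n, ∃ K : Set G, IsCompact K ∧ ∃ ε : ℝ, 0 < ε ∧ (S n).IsNormalFolner K ε) ∧
  ∀ K : Set G, IsCompact K → ∀ u ∈ units G,
    Tendsto (fun n => ((outerBoundary K (fiber (S n).carrier u)).ncard : ℝ) /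
      ((fiber (S n).carrier u).ncard : ℝ)) atTop (𝓝 0)

/-- A compact open elementary subgroupoid: a compact open subset that is closed under products
and inverses and is principal. -/
structure IsElementarySubgroupoid (H : Set G) : Prop where
  isCompact : IsCompact H
  isOpen : IsOpen H
  comp_mem : ∀ x ∈ H, ∀ y ∈ H, ∀ h : s x = r y, comp x y h ∈ H
  inv_mem : ∀ x ∈ H, inv x ∈ H
  principal : ∀ x ∈ H, s x = r x → x ∈ units G

end Topology

/-- A finite family of sets, counted with multiplicity, is at most `n`-colorable if it splits into
at most `n` subfamilies, each consisting of pairwise disjoint sets. -/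
def AtMostColorable {α ι : Type*} (n : ℕ) (A : ι → Set α) : Prop :=
  ∃ c : ι → Fin n, ∀ i j, i ≠ j → c i = c j → Disjoint (A i) (A j)

section Measure

variable (G : Type*) [TopologicalSpace G] [MeasurableSpace G] [BorelSpace G] [ArrowGroupoid G]

/-- `M(G)`: the Borel probability measures on the unit space that are invariant, i.e. satisfy
`μ(s(U)) = μ(r(U))` for every open bisection `U`. -/
def invariantMeasures : Set (Measure (units G)) :=
  {μ | IsProbabilityMeasure μ ∧ ∀ U : Set G, IsOpen U → IsBisection U →
    μ (Subtype.val ⁻¹' (s '' U)) = μ (Subtype.val ⁻¹' (r '' U))}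

variable {G}

/-- `S` is `(M, ε)`-good. That an infimum over `M(G)` is larger than `1 - ε` is expressed by a lower
bound `c > 1 - ε`. -/
def TowerSystem.IsGood (T : TowerSystem G) (M : ℕ) (ε : ℝ) : Prop :=
  ∃ f : ∀ l : Fin T.m, Fin T.height → Fin (T.size l),
    (∀ l, Function.Injective (f l)) ∧
    (∀ l (k : Fin T.height), (k : ℕ) = 0 → f l k = T.base l) ∧
    (∀ k : Fin T.height, ∀ μ ∈ invariantMeasures G,
      1 - ε ≤ μ.real (Subtype.val ⁻¹' ⋃ l, T.C l (f l k) (f l k))) ∧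
    ∃ L : Finset (Fin T.m),
      (∃ c : ℝ, 1 - ε < c ∧ ∀ μ ∈ invariantMeasures G,
        c ≤ μ.real (Subtype.val ⁻¹' ⋃ l ∈ L, T.C l (T.base l) (T.base l))) ∧
      ∀ k : Fin T.height, AtMostColorable M (fun l : L => T.C l (f l k) (f l k))

variable (G)

/-- Almost finiteness in measure. -/
def AlmostFiniteInMeasure : Prop :=
  ∀ K : Set G, IsCompact K → ∀ ε : ℝ, 0 < ε →
    ∃ H : Set G, IsElementarySubgroupoid H ∧
      (∀ u ∈ H ∩ units G, (outerBoundary K (fiber H u)).Finite ∧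
        ((outerBoundary K (fiber H u)).ncard : ℝ) < ε * ((fiber H u).ncard : ℝ)) ∧
      ∀ μ ∈ invariantMeasures G, 1 - ε < μ.real (Subtype.val ⁻¹' H)

end Measure

end ArrowGroupoid

/-! The proof is a tiling argument by exhaustion. A compact open `Z` on which `r` is injective
partitions `r '' Z` into tiles, one for each `c`, namely the ranges of `fiber Z c`. Then
`tileGroupoid Z`, the product of `Z` and its inverse, is elementary with unit space `r '' Z`, and
its source fibers are right translates of the fibers of `Z`. It therefore suffices to find `Z` whose
fibers have small outer boundary and whose range is large for all invariant measures simultaneously.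

Such a `Z` is enlarged by adding the uncovered part of each sufficiently invariant Følner tile that
is still mostly uncovered (`IsTiling.exists_extension`). Afterwards every invariant tile is covered
up to a fixed proportion `α`. `covering_gain` shows that this costs a definite amount of new
measure. For most uncovered units `c`, the tile of `c` misses the old range, because that range is
nearly invariant under the inverse of the Følner set; so the covered part of the tile is new. By
`mass_transport`, this is compared with the number of tiles through a new point. Controlled height
and `M`-colorability bound that number by the height times `M`, and the height cancels.

The gain `θ ^ 2 / (32 * M)` does not depend on the stage, so finitely many stages suffice. The
Følner condition is only pointwise; `exists_forall_measureReal_lt` replaces uniformity by finitely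
many Følner sets, one of which works for each measure. -/

namespace ArrowGroupoid

/-! ### Groupoid algebra with a total product -/

section GroupoidAlgebra

variable {G : Type*} [ArrowGroupoid G]

open Classical in
/-- The product of two arrows, with the value `x` when `x` and `y` are not composable. -/
noncomputable def mul (x y : G) : G := if h : s x = r y then comp x y h else x

theorem mul_eq_comp {x y : G} (h : s x = r y) : mul x y = comp x y h := dif_pos h

theorem s_mul {x y : G} (h : s x = r y) : s (mul x y) = s y := by
  rw [mul_eq_comp h, s_comp]

theorem r_mul {x y : G} (h : s x = r y) : r (mul x y) = r x := by
  rw [mul_eq_comp h, r_comp]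

theorem mul_assoc' {x y z : G} (hxy : s x = r y) (hyz : s y = r z) :
    mul (mul x y) z = mul x (mul y z) := by
  have h₁ : s (comp x y hxy) = r z := by rw [s_comp, hyz]
  have h₂ : s x = r (comp y z hyz) := by rw [r_comp, hxy]
  rw [mul_eq_comp hxy, mul_eq_comp hyz, mul_eq_comp h₁, mul_eq_comp h₂]
  exact comp_assoc x y z hxy hyz h₁ h₂

theorem mul_s (x : G) : mul x (s x) = x := by
  rw [mul_eq_comp (r_s x).symm, comp_unit]

theorem r_mul_self (x : G) : mul (r x) x = x := by
  rw [mul_eq_comp (s_r x), unit_comp]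

theorem mul_inv_self (x : G) : mul x (inv x) = r x := by
  rw [mul_eq_comp (r_inv x).symm, comp_inv]

theorem inv_mul_self (x : G) : mul (inv x) x = s x := by
  rw [mul_eq_comp (s_inv x), inv_comp]

theorem inv_mul_cancel_left' {x y : G} (h : s x = r y) : mul (inv x) (mul x y) = y := by
  rw [← mul_assoc' (s_inv x) h, inv_mul_self, h, r_mul_self]

theorem mul_inv_cancel_right' {x y : G} (h : s x = r y) : mul (mul x y) (inv y) = x := by
  rw [mul_assoc' h (r_inv y).symm, mul_inv_self, ← h, mul_s]

theorem inv_inv' (x : G) : inv (inv x) = x := by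
  have h := inv_mul_cancel_left' (s_inv x)
  rwa [inv_mul_self, ← r_inv x, ← s_inv (inv x), mul_s] at h

theorem mul_inv_cancel_left' {x y : G} (h : r x = r y) : mul x (mul (inv x) y) = y := by
  have h' := inv_mul_cancel_left' (x := inv x) (y := y) (by rw [s_inv, h])
  rwa [inv_inv'] at h'

theorem inv_mul_cancel_right' {x y : G} (h : s x = s y) : mul (mul x (inv y)) y = x := by
  have h' := mul_inv_cancel_right' (x := x) (y := inv y) (by rw [r_inv, h])
  rwa [inv_inv'] at h'

theorem mul_right_injOn (y : G) : Set.InjOn (fun x : G => mul x y) {x | s x = r y} := by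
  intro x hx x' hx' h
  have h' := congrArg (fun z => mul z (inv y)) h
  simpa only [mul_inv_cancel_right' hx, mul_inv_cancel_right' hx'] using h'

theorem s_mem_units (x : G) : s x ∈ units G := ⟨x, rfl⟩

theorem r_mem_units (x : G) : r x ∈ units G := ⟨r x, s_r x⟩

theorem s_of_mem_units {u : G} (hu : u ∈ units G) : s u = u := by
  obtain ⟨x, rfl⟩ := hu; exact s_s x

theorem r_of_mem_units {u : G} (hu : u ∈ units G) : r u = u := by
  obtain ⟨x, rfl⟩ := hu; exact r_s x

theorem mem_setMul {A B : Set G} {z : G} :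
    z ∈ setMul A B ↔ ∃ x ∈ A, ∃ y ∈ B, s x = r y ∧ mul x y = z := by
  constructor
  · rintro ⟨x, hx, y, hy, h, rfl⟩
    exact ⟨x, hx, y, hy, h, mul_eq_comp h⟩
  · rintro ⟨x, hx, y, hy, h, rfl⟩
    exact ⟨x, hx, y, hy, h, (mul_eq_comp h).symm⟩

theorem mul_mem_setMul {A B : Set G} {x y : G} (hx : x ∈ A) (hy : y ∈ B) (h : s x = r y) :
    mul x y ∈ setMul A B := mem_setMul.2 ⟨x, hx, y, hy, h, rfl⟩

theorem setMul_mono {A A' B B' : Set G} (hA : A ⊆ A') (hB : B ⊆ B') :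
    setMul A B ⊆ setMul A' B' := by
  rintro z ⟨x, hx, y, hy, h, e⟩
  exact ⟨x, hA hx, y, hB hy, h, e⟩

theorem setMul_union_right (A B C : Set G) :
    setMul A (B ∪ C) = setMul A B ∪ setMul A C := by
  ext z
  constructor
  · rintro ⟨x, hx, y, hy | hy, h, e⟩
    · exact Or.inl ⟨x, hx, y, hy, h, e⟩
    · exact Or.inr ⟨x, hx, y, hy, h, e⟩
  · rintro (h | h)
    · exact setMul_mono le_rfl Set.subset_union_left h
    · exact setMul_mono le_rfl Set.subset_union_right h

theorem setMul_fiber (A B : Set G) (u : G) : setMul A (fiber B u) = fiber (setMul A B) u := by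
  ext z
  simp only [mem_setMul, fiber, Set.mem_ofPred_eq]
  constructor
  · rintro ⟨x, hx, y, ⟨hy, hu⟩, h, rfl⟩
    exact ⟨⟨x, hx, y, hy, h, rfl⟩, by rw [s_mul h, hu]⟩
  · rintro ⟨⟨x, hx, y, hy, h, rfl⟩, hu⟩
    exact ⟨x, hx, y, ⟨hy, by rw [← hu, s_mul h]⟩, h, rfl⟩

theorem fiber_diff (A B : Set G) (u : G) : fiber (A \ B) u = fiber A u \ fiber B u := by
  ext z
  simp only [fiber, Set.mem_ofPred_eq, Set.mem_sdiff]
  tauto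

theorem fiber_union (A B : Set G) (u : G) : fiber (A ∪ B) u = fiber A u ∪ fiber B u := by
  ext z
  simp only [fiber, Set.mem_ofPred_eq, Set.mem_union]
  tauto

theorem fiber_mono {A B : Set G} (h : A ⊆ B) (u : G) : fiber A u ⊆ fiber B u :=
  fun _ hx => ⟨h hx.1, hx.2⟩

theorem outerBoundary_fiber (K A : Set G) (u : G) :
    outerBoundary K (fiber A u) = fiber (outerBoundary K A) u := by
  rw [outerBoundary, setMul_fiber, outerBoundary, fiber_diff]

/-- The part of `A` in the range fiber over `u`. -/
def rangeFiber (A : Set G) (u : G) : Set G := {x | x ∈ A ∧ r x = u}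

theorem rangeFiber_union (A B : Set G) (u : G) :
    rangeFiber (A ∪ B) u = rangeFiber A u ∪ rangeFiber B u := by
  ext z
  simp only [rangeFiber, Set.mem_ofPred_eq, Set.mem_union]
  tauto

end GroupoidAlgebra

/-! ### Compact open sets and bisections in an ample groupoid -/

section AmpleTopology

/-- A compact open set. -/
def IsCompactOpen {X : Type*} [TopologicalSpace X] (A : Set X) : Prop := IsCompact A ∧ IsOpen A

namespace IsCompactOpen

variable {X : Type*} [TopologicalSpace X] {A B : Set X}

theorem empty : IsCompactOpen (∅ : Set X) := ⟨isCompact_empty, isOpen_empty⟩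

theorem union (hA : IsCompactOpen A) (hB : IsCompactOpen B) : IsCompactOpen (A ∪ B) :=
  ⟨hA.1.union hB.1, hA.2.union hB.2⟩

theorem biUnion {ι : Type*} {f : ι → Set X} (t : Finset ι) (h : ∀ i ∈ t, IsCompactOpen (f i)) :
    IsCompactOpen (⋃ i ∈ t, f i) :=
  ⟨t.isCompact_biUnion fun i hi => (h i hi).1, isOpen_biUnion fun i hi => (h i hi).2⟩

theorem iUnion {ι : Type*} [Finite ι] {f : ι → Set X} (h : ∀ i, IsCompactOpen (f i)) :
    IsCompactOpen (⋃ i, f i) :=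
  ⟨isCompact_iUnion fun i => (h i).1, isOpen_iUnion fun i => (h i).2⟩

theorem inter_isClopen (hA : IsCompactOpen A) (hB : IsClopen B) : IsCompactOpen (A ∩ B) :=
  ⟨hA.1.inter_right hB.1, hA.2.inter hB.2⟩

variable [T2Space X]

theorem isClosed (hA : IsCompactOpen A) : IsClosed A := hA.1.isClosed

theorem isClopen (hA : IsCompactOpen A) : IsClopen A := ⟨hA.isClosed, hA.2⟩

theorem inter (hA : IsCompactOpen A) (hB : IsCompactOpen B) : IsCompactOpen (A ∩ B) :=
  hA.inter_isClopen hB.isClopen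

theorem diff (hA : IsCompactOpen A) (hB : IsCompactOpen B) : IsCompactOpen (A \ B) :=
  hA.inter_isClopen hB.isClopen.compl

end IsCompactOpen

variable {G : Type*} [TopologicalSpace G] [ArrowGroupoid G]

theorem IsBisection.mono {A B : Set G} (hB : IsBisection B) (h : A ⊆ B) : IsBisection A := by
  obtain ⟨U, hU, hBU, h'⟩ := hB
  exact ⟨U, hU, h.trans hBU, h'⟩

theorem IsBisection.injOn_s {B : Set G} (hB : IsBisection B) : Set.InjOn (s : G → G) B := by
  obtain ⟨U, -, hBU, h, -⟩ := hB
  intro x hx y hy hxy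
  have := h.injective (a₁ := ⟨x, hBU hx⟩) (a₂ := ⟨y, hBU hy⟩) hxy
  exact congrArg Subtype.val this

theorem IsBisection.injOn_r {B : Set G} (hB : IsBisection B) : Set.InjOn (r : G → G) B := by
  obtain ⟨U, -, hBU, -, h⟩ := hB
  intro x hx y hy hxy
  have := h.injective (a₁ := ⟨x, hBU hx⟩) (a₂ := ⟨y, hBU hy⟩) hxy
  exact congrArg Subtype.val this

theorem r_comp_inv {G : Type*} [ArrowGroupoid G] : (r : G → G) ∘ inv = s := funext r_inv

variable [IsAmple G]

theorem continuous_r : Continuous (r : G → G) := IsAmple.etale.continuous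

theorem continuous_inv : Continuous (inv : G → G) := IsAmple.continuous_inv

theorem continuous_s : Continuous (s : G → G) := by
  rw [← r_comp_inv]; exact continuous_r.comp continuous_inv

variable (G) in
/-- Inversion of arrows as a homeomorphism. -/
def invHomeomorph : G ≃ₜ G where
  toFun := inv
  invFun := inv
  left_inv := inv_inv'
  right_inv := inv_inv'
  continuous_toFun := continuous_inv
  continuous_invFun := continuous_inv

theorem isOpenMap_r : IsOpenMap (r : G → G) := IsAmple.etale.isOpenMap

theorem isOpenMap_s : IsOpenMap (s : G → G) := by
  rw [← r_comp_inv]; exact isOpenMap_r.comp (invHomeomorph G).isOpenMap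

theorem IsCompactOpen.image_r {A : Set G} (hA : IsCompactOpen A) : IsCompactOpen (r '' A) :=
  ⟨hA.1.image continuous_r, isOpenMap_r _ hA.2⟩

theorem IsCompactOpen.image_s {A : Set G} (hA : IsCompactOpen A) : IsCompactOpen (s '' A) :=
  ⟨hA.1.image continuous_s, isOpenMap_s _ hA.2⟩

theorem IsCompactOpen.image_inv {A : Set G} (hA : IsCompactOpen A) : IsCompactOpen (inv '' A) :=
  ⟨hA.1.image continuous_inv, (invHomeomorph G).isOpenMap _ hA.2⟩

theorem isOpen_units : IsOpen (units G) := by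
  have h := (isOpenMap_s (G := G)) Set.univ isOpen_univ
  rwa [Set.image_univ] at h

theorem isCompact_setMul [T2Space G] {A B : Set G} (hA : IsCompact A) (hB : IsCompact B) :
    IsCompact (setMul A B) := by
  have hcl : IsClosed {p : G × G | s p.1 = r p.2} :=
    isClosed_eq (continuous_s.comp continuous_fst) (continuous_r.comp continuous_snd)
  have hK : IsCompact ((Subtype.val : {p : G × G // s p.1 = r p.2} → G × G) ⁻¹' (A ×ˢ B)) :=
    hcl.isClosedEmbedding_subtypeVal.isCompact_preimage (hA.prod hB)
  convert hK.image (IsAmple.continuous_comp (G := G)) using 1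
  ext z
  constructor
  · rintro ⟨x, hx, y, hy, h, rfl⟩
    exact ⟨⟨(x, y), h⟩, ⟨hx, hy⟩, rfl⟩
  · rintro ⟨⟨⟨x, y⟩, h⟩, ⟨hx, hy⟩, rfl⟩
    exact ⟨x, hx, y, hy, h, rfl⟩

/-- Étaleness gives a local section `σ` of `r` through `x`. Every `w` near `x y` factors as `σ (r
w)` times `(σ (r w))⁻¹ w`, and both factors depend continuously on `w`. -/
theorem isOpen_setMul {A B : Set G} (hA : IsOpen A) (hB : IsOpen B) : IsOpen (setMul A B) := by
  rw [isOpen_iff_mem_nhds]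
  intro z hz
  obtain ⟨x, hx, y, hy, hxy, rfl⟩ := mem_setMul.1 hz
  obtain ⟨e, hxe, he⟩ := IsAmple.etale (G := G) x
  have hrz : r (mul x y) = r x := r_mul hxy
  let U : Set G := r ⁻¹' e.target
  have hUo : IsOpen U := e.open_target.preimage continuous_r
  have hzU : mul x y ∈ U := by
    change r (mul x y) ∈ e.target
    rw [hrz, he]; exact e.map_source hxe
  have hre : ∀ w : U, r (e.symm (r w.1)) = r w.1 := fun w => by
    have h := e.right_inv w.2
    rwa [← he] at h
  have hcont : Continuous fun w : U => e.symm (r w.1) :=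
    e.continuousOn_symm.comp_continuous (continuous_r.comp continuous_subtype_val) fun w => w.2
  have hc : Continuous fun w : U =>
      (⟨(inv (e.symm (r w.1)), w.1), by rw [s_inv, hre]⟩ : {p : G × G // s p.1 = r p.2}) :=
    ((continuous_inv.comp hcont).prodMk continuous_subtype_val).subtype_mk _
  have hc' := IsAmple.continuous_comp.comp hc
  let V : Set U := {w | e.symm (r w.1) ∈ A} ∩ {w | comp (inv (e.symm (r w.1))) w.1
    (by rw [s_inv, hre]) ∈ B}
  have hV : IsOpen V := (hA.preimage hcont).inter (hB.preimage hc')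
  have hxe' : e.symm (r (mul x y)) = x := by
    rw [hrz]; conv_lhs => rw [he]
    exact e.left_inv hxe
  have hzV : (⟨mul x y, hzU⟩ : U) ∈ V := by
    refine ⟨?_, ?_⟩
    · change e.symm (r (mul x y)) ∈ A
      rwa [hxe']
    · change comp (inv (e.symm (r (mul x y)))) (mul x y) _ ∈ B
      rw [← mul_eq_comp, hxe', inv_mul_cancel_left' hxy]
      exact hy
  refine mem_of_superset ((hUo.isOpenMap_subtype_val V hV).mem_nhds ⟨_, hzV, rfl⟩) ?_
  rintro _ ⟨w, ⟨hw1, hw2⟩, rfl⟩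
  refine mem_setMul.2 ⟨_, hw1, _, hw2, ?_, ?_⟩
  · rw [r_comp, r_inv]
  · rw [← mul_eq_comp, mul_inv_cancel_left' (hre w)]

theorem IsCompactOpen.setMul [T2Space G] {A B : Set G} (hA : IsCompactOpen A)
    (hB : IsCompactOpen B) : IsCompactOpen (setMul A B) :=
  ⟨isCompact_setMul hA.1 hB.1, isOpen_setMul hA.2 hB.2⟩

theorem exists_finset_bisections {A O : Set G} (hA : IsCompact A) (hO : IsOpen O) (hAO : A ⊆ O) :
    ∃ (t : Finset G) (U : G → Set G), (∀ x ∈ t, IsCompactOpen (U x) ∧ IsBisection (U x) ∧ U x ⊆ O) ∧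
      A ⊆ ⋃ x ∈ t, U x := by
  have h : ∀ x : G, ∃ U : Set G, x ∈ A →
      U ∈ 𝓝 x ∧ IsCompactOpen U ∧ IsBisection U ∧ U ⊆ O := by
    intro x
    by_cases hx : x ∈ A
    · obtain ⟨U, ⟨hU1, hU2, hU3⟩, hxU, hUO⟩ :=
        IsAmple.basis.exists_subset_of_mem_open (hAO hx) hO
      exact ⟨U, fun _ => ⟨hU2.mem_nhds hxU, ⟨hU1, hU2⟩, hU3, hUO⟩⟩
    · exact ⟨∅, fun h => absurd h hx⟩
  choose U hU using h
  obtain ⟨t, htA, ht⟩ := hA.elim_nhds_subcover U fun x hx => (hU x hx).1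
  exact ⟨t, U, fun x hx => (hU x (htA x hx)).2, ht⟩

theorem exists_isCompactOpen_superset {K : Set G} (hK : IsCompact K) :
    ∃ K', IsCompactOpen K' ∧ K ⊆ K' := by
  obtain ⟨t, U, hU, h⟩ := exists_finset_bisections hK isOpen_univ (Set.subset_univ K)
  exact ⟨_, IsCompactOpen.biUnion t fun x hx => (hU x hx).1, h⟩

/-- Compact open sets are built from the empty set by adding disjoint compact open bisections. -/
theorem IsCompactOpen.induction [T2Space G] {P : Set G → Prop} (h0 : P ∅)
    (hstep : ∀ A B, IsCompactOpen A → IsCompactOpen B → IsBisection B → Disjoint A B → P A →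
      P (A ∪ B)) {A : Set G} (hA : IsCompactOpen A) : P A := by
  obtain ⟨t, U, hU, h⟩ := exists_finset_bisections hA.1 hA.2 le_rfl
  have key : ∀ t : Finset G, (∀ x ∈ t, IsCompactOpen (U x) ∧ IsBisection (U x) ∧ U x ⊆ A) →
      P (⋃ x ∈ t, U x) := by
    classical
    intro t
    induction t using Finset.induction_on with
    | empty => intro _; simpa using h0
    | insert a t _ ih =>
      intro ht
      have ht' : ∀ x ∈ t, IsCompactOpen (U x) ∧ IsBisection (U x) ∧ U x ⊆ A :=
        fun x hx => ht x (Finset.mem_insert_of_mem hx)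
      have hco := IsCompactOpen.biUnion t fun x hx => (ht' x hx).1
      have ha := ht a (Finset.mem_insert_self a t)
      have := hstep _ (U a \ ⋃ x ∈ t, U x) hco (ha.1.diff hco) (ha.2.1.mono Set.sdiff_subset)
        Set.disjoint_sdiff_right (ih ht')
      rwa [Set.union_sdiff_self, Set.union_comm, ← Finset.set_biUnion_insert] at this
  have hAU : A = ⋃ x ∈ t, U x := le_antisymm h (Set.iUnion₂_subset fun x hx => (hU x hx).2.2)
  rw [hAU]
  exact key t hU

end AmpleTopology

/-! ### Fiber counts and mass transport -/

section Degree

theorem fiber_disjoint {G : Type*} [ArrowGroupoid G] {A B : Set G} (h : Disjoint A B) (u : G) :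
    Disjoint (fiber A u) (fiber B u) :=
  h.mono (fun _ hx => hx.1) (fun _ hx => hx.1)

theorem rangeFiber_disjoint {G : Type*} [ArrowGroupoid G] {A B : Set G} (h : Disjoint A B) (u : G) :
    Disjoint (rangeFiber A u) (rangeFiber B u) :=
  h.mono (fun _ hx => hx.1) (fun _ hx => hx.1)

variable {G : Type*} [TopologicalSpace G] [ArrowGroupoid G]

theorem subsingleton_fiber {B : Set G} (hB : IsBisection B) (u : G) :
    (fiber B u).Subsingleton :=
  fun _ hx _ hy => hB.injOn_s hx.1 hy.1 (hx.2.trans hy.2.symm)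

theorem subsingleton_rangeFiber {B : Set G} (hB : IsBisection B) (u : G) :
    (rangeFiber B u).Subsingleton :=
  fun _ hx _ hy => hB.injOn_r hx.1 hy.1 (hx.2.trans hy.2.symm)

theorem ncard_eq_indicator_of_subsingleton {α β : Type*} {A : β → Set α} {D : Set β}
    (h : ∀ u, (A u).Subsingleton) (hD : ∀ u, u ∈ D ↔ (A u).Nonempty) :
    (fun u => (A u).ncard) = D.indicator 1 := by
  funext u
  by_cases hu : u ∈ D
  · obtain ⟨x, hx⟩ := (hD u).1 hu
    rw [Set.indicator_of_mem hu, (h u).eq_singleton_of_mem hx]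
    exact Set.ncard_singleton x
  · rw [Set.indicator_of_notMem hu,
      Set.not_nonempty_iff_eq_empty.1 (fun hne => hu ((hD u).2 hne)), Set.ncard_empty]

theorem ncard_fiber_of_isBisection {B : Set G} (hB : IsBisection B) :
    (fun u => (fiber B u).ncard) = (s '' B).indicator 1 :=
  ncard_eq_indicator_of_subsingleton (subsingleton_fiber hB) fun _ => Iff.rfl

theorem ncard_rangeFiber_of_isBisection {B : Set G} (hB : IsBisection B) :
    (fun u => (rangeFiber B u).ncard) = (r '' B).indicator 1 :=
  ncard_eq_indicator_of_subsingleton (subsingleton_rangeFiber hB) fun _ => Iff.rfl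

theorem IsCompactOpen.measurableSet_preimage [MeasurableSpace G] [BorelSpace G] {P : Set G}
    (hP : IsCompactOpen P) : MeasurableSet (Subtype.val ⁻¹' P : Set (units G)) :=
  measurable_subtype_coe hP.2.measurableSet

theorem integral_indicator_preimage [MeasurableSpace G] [BorelSpace G] {P : Set G} (hP : IsCompactOpen P) (μ : Measure (units G))
    [IsProbabilityMeasure μ] :
    Integrable (fun u : units G => ((P.indicator (1 : G → ℕ) u : ℕ) : ℝ)) μ ∧
      ∫ u : units G, ((P.indicator (1 : G → ℕ) u : ℕ) : ℝ) ∂μ =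
        μ.real (Subtype.val ⁻¹' P : Set (units G)) := by
  have h : (fun u : units G => ((P.indicator (1 : G → ℕ) u : ℕ) : ℝ)) =
      (Subtype.val ⁻¹' P : Set (units G)).indicator 1 := by
    funext u
    by_cases hu : (u : G) ∈ P
    · rw [Set.indicator_of_mem hu, Set.indicator_of_mem (by exact hu)]; simp
    · rw [Set.indicator_of_notMem hu, Set.indicator_of_notMem (by exact hu)]; simp
  rw [h]
  exact ⟨(integrable_const (1 : ℝ)).indicator hP.measurableSet_preimage, integral_indicator_one hP.measurableSet_preimage⟩

variable [IsAmple G] [T2Space G]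

theorem IsCompactOpen.finite_fiber {A : Set G} (hA : IsCompactOpen A) (u : G) :
    (fiber A u).Finite := by
  refine IsCompactOpen.induction (P := fun A => (fiber A u).Finite)
    (Set.finite_empty.subset fun x hx => hx.1) (fun A B _ _ hB _ ih => ?_) hA
  · rw [fiber_union]
    exact ih.union (subsingleton_fiber hB u).finite

theorem IsCompactOpen.finite_rangeFiber {A : Set G} (hA : IsCompactOpen A) (u : G) :
    (rangeFiber A u).Finite := by
  refine IsCompactOpen.induction (P := fun A => (rangeFiber A u).Finite)
    (Set.finite_empty.subset fun x hx => hx.1) (fun A B _ _ hB _ ih => ?_) hA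
  · rw [rangeFiber_union]
    exact ih.union (subsingleton_rangeFiber hB u).finite

theorem ncard_fiber_union {A B : Set G} (hA : IsCompactOpen A) (hB : IsCompactOpen B)
    (h : Disjoint A B) (u : G) :
    (fiber (A ∪ B) u).ncard = (fiber A u).ncard + (fiber B u).ncard := by
  rw [fiber_union, Set.ncard_union_eq (fiber_disjoint h u) (hA.finite_fiber u) (hB.finite_fiber u)]

theorem ncard_rangeFiber_union {A B : Set G} (hA : IsCompactOpen A) (hB : IsCompactOpen B)
    (h : Disjoint A B) (u : G) :
    (rangeFiber (A ∪ B) u).ncard = (rangeFiber A u).ncard + (rangeFiber B u).ncard := by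
  rw [rangeFiber_union, Set.ncard_union_eq (rangeFiber_disjoint h u) (hA.finite_rangeFiber u)
    (hB.finite_rangeFiber u)]

/-- The count is a finite sum of indicators of clopen sets `s '' B`. Together with
`IsCompactOpen.sep`, this keeps sets of base points selected by inequalities between fiber counts
compact open. -/
theorem IsCompactOpen.isLocallyConstant_ncard_fiber {A : Set G} (hA : IsCompactOpen A) :
    IsLocallyConstant fun u : G => (fiber A u).ncard := by
  refine IsCompactOpen.induction
    (P := fun A => IsLocallyConstant fun u : G => (fiber A u).ncard) ?_ ?_ hA
  · have h : ∀ u : G, fiber (∅ : Set G) u = ∅ := fun u => Set.eq_empty_of_forall_notMem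
      fun x hx => hx.1
    simp only [h, Set.ncard_empty]
    exact IsLocallyConstant.const 0
  · intro A B hA hB hB' hd ih
    simp only [ncard_fiber_union hA hB hd]
    refine ih.add ?_
    rw [ncard_fiber_of_isBisection hB']
    exact (IsLocallyConstant.iff_continuous _).2
      (continuous_one.indicator fun x hx => by
        rw [hB.image_s.isClopen.frontier_eq] at hx
        exact absurd hx (Set.notMem_empty x))

theorem IsCompactOpen.sep {X : Type*} [TopologicalSpace X] {P : Set X} (hP : IsCompactOpen P) {Y : Type*} {f : X → Y}
    (hf : IsLocallyConstant f) (p : Y → Prop) : IsCompactOpen {c | c ∈ P ∧ p (f c)} :=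
  hP.inter_isClopen (B := f ⁻¹' {y | p y}) ⟨⟨by
    rw [← Set.preimage_compl]; exact hf _⟩, hf _⟩

theorem IsCompactOpen.sep_s_mem {A P : Set G} (hA : IsCompactOpen A) (hP : IsCompactOpen P) :
    IsCompactOpen {x | x ∈ A ∧ s x ∈ P} :=
  hA.inter_isClopen (hP.isClopen.preimage continuous_s)

theorem IsCompactOpen.sep_r_mem {A P : Set G} (hA : IsCompactOpen A) (hP : IsCompactOpen P) :
    IsCompactOpen {x | x ∈ A ∧ r x ∈ P} :=
  hA.inter_isClopen (hP.isClopen.preimage continuous_r)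

theorem IsCompactOpen.sep_r_notMem {A P : Set G} (hA : IsCompactOpen A) (hP : IsCompactOpen P) :
    IsCompactOpen {x | x ∈ A ∧ r x ∉ P} :=
  hA.inter_isClopen (hP.isClopen.preimage continuous_r).compl

variable [MeasurableSpace G] [BorelSpace G]

/-- Mass transport: over an invariant measure, a compact open set has the same average number of
arrows in its source fibers and in its range fibers. -/
theorem mass_transport {A : Set G} (hA : IsCompactOpen A) {μ : Measure (units G)}
    (hμ : μ ∈ invariantMeasures G) :
    Integrable (fun u : units G => ((fiber A u).ncard : ℝ)) μ ∧
    Integrable (fun u : units G => ((rangeFiber A u).ncard : ℝ)) μ ∧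
      ∫ u : units G, ((fiber A u).ncard : ℝ) ∂μ =
        ∫ u : units G, ((rangeFiber A u).ncard : ℝ) ∂μ := by
  have := hμ.1
  refine IsCompactOpen.induction (P := fun A =>
    Integrable (fun u : units G => ((fiber A u).ncard : ℝ)) μ ∧
    Integrable (fun u : units G => ((rangeFiber A u).ncard : ℝ)) μ ∧
      ∫ u : units G, ((fiber A u).ncard : ℝ) ∂μ =
        ∫ u : units G, ((rangeFiber A u).ncard : ℝ) ∂μ) ?_ ?_ hA
  · have h : ∀ u : G, fiber (∅ : Set G) u = ∅ := fun u => Set.eq_empty_of_forall_notMem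
      fun x hx => hx.1
    have h' : ∀ u : G, rangeFiber (∅ : Set G) u = ∅ := fun u => Set.eq_empty_of_forall_notMem
      fun x hx => hx.1
    simp [h, h']
  · intro A B hA hB hB' hd ih
    obtain ⟨h1, h2, h3⟩ := ih
    have hs := integral_indicator_preimage hB.image_s μ
    have hr := integral_indicator_preimage hB.image_r μ
    rw [← ncard_fiber_of_isBisection hB'] at hs
    rw [← ncard_rangeFiber_of_isBisection hB'] at hr
    simp only [ncard_fiber_union hA hB hd, ncard_rangeFiber_union hA hB hd, Nat.cast_add]
    refine ⟨h1.add hs.1, h2.add hr.1, ?_⟩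
    rw [integral_add h1 hs.1, integral_add h2 hr.1, h3, hs.2, hr.2, Measure.real, Measure.real,
      hμ.2 B hB.2 hB']

end Degree

/-! ### From pointwise smallness to smallness for all measures -/

/-- If every point of a compact space lies in only finitely many of the clopen sets `B n`, then
some initial segment of the sequence contains, for each probability measure, a set of small
measure. -/
theorem exists_forall_measureReal_lt {X : Type*} [TopologicalSpace X] [CompactSpace X]
    [MeasurableSpace X] [OpensMeasurableSpace X] {B : ℕ → Set X} (hB : ∀ n, IsClopen (B n))
    (hx : ∀ x, ∀ᶠ n in atTop, x ∉ B n) {δ : ℝ} (hδ : 0 < δ) :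
    ∃ N, ∀ μ : Measure X, IsProbabilityMeasure μ → ∃ n < N, μ.real (B n) < δ := by
  by_contra! hcon
  choose μ hμ hμB using hcon
  -- Limits along one ultrafilter exist for all sets at once. The limit need not be countably
  -- additive, so only finite unions are used below.
  have hlim : ∀ C : Set X, ∃ a : ℝ,
      Tendsto (fun N => (μ N).real C) (hyperfilter ℕ : Filter ℕ) (𝓝 a) := by
    intro C
    obtain ⟨a, -, ha⟩ := (isCompact_Icc (a := (0 : ℝ)) (b := 1)).ultrafilter_le_nhds
      ((hyperfilter ℕ).map fun N => (μ N).real C) (by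
        rw [le_principal_iff]
        exact mem_map.2 (univ_mem' fun N => ⟨measureReal_nonneg, measureReal_le_one⟩))
    exact ⟨a, ha⟩
  choose ν hν using hlim
  have hνle : ∀ C, ν C ≤ 1 := fun C => le_of_tendsto' (hν C) fun N => measureReal_le_one
  have hνB : ∀ n, δ ≤ ν (B n) := by
    intro n
    refine ge_of_tendsto (hν (B n)) ?_
    have h : ∀ᶠ N in (hyperfilter ℕ : Filter ℕ), n < N :=
      (Nat.hyperfilter_le_atTop) (eventually_gt_atTop n)
    exact h.mono fun N hN => hμB N n hN
  let C : ℕ → ℕ → Set X := fun n m => ⋃ i ∈ Finset.Icc n m, B i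
  have hC : ∀ n m, IsClopen (C n m) := fun n m => isClopen_biUnion_finset fun i _ => hB i
  have hCmono : ∀ n {m m'}, m ≤ m' → C n m ⊆ C n m' := fun n m m' h =>
    Set.biUnion_mono (fun i hi => by
      have := Finset.mem_Icc.1 hi
      exact Finset.mem_Icc.2 ⟨this.1, this.2.trans h⟩) fun _ _ => le_rfl
  -- The tail union from `n` on is replaced by a finite, hence clopen, union of almost the same
  -- limit mass. The errors `δ / 2 ^ (n + 2)` sum to at most `δ / 2`.
  have hmax : ∀ n, ∃ m, ∀ m', ν (C n m') ≤ ν (C n m) + δ / 2 ^ (n + 2) := by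
    intro n
    have hbdd : BddAbove (Set.range fun m => ν (C n m)) := ⟨1, by rintro _ ⟨m, rfl⟩; exact hνle _⟩
    obtain ⟨m, hm⟩ := exists_lt_of_lt_ciSup (f := fun m => ν (C n m))
      (b := (⨆ m, ν (C n m)) - δ / 2 ^ (n + 2)) (by
        have : 0 < δ / 2 ^ (n + 2) := by positivity
        linarith)
    exact ⟨m, fun m' => by linarith [le_ciSup hbdd m']⟩
  choose m hm using hmax
  let t : ℕ → Set X := fun N => ⋂ n ∈ Finset.range (N + 1), C n (m n)
  have htne : ∀ N, (t N).Nonempty := by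
    intro N
    by_contra hne
    rw [Set.not_nonempty_iff_eq_empty] at hne
    let m' : ℕ := max N ((Finset.range (N + 1)).sup m)
    -- If `t N` were empty, each point of `B N` would be missed by some truncation, and the mass of
    -- `B N` would be at most the sum of the errors, against `hνB`.
    have hsub : B N ⊆ ⋃ n ∈ Finset.range (N + 1), (C n m' \ C n (m n)) := by
      intro x hxN
      have hxt : x ∉ t N := by rw [hne]; exact Set.notMem_empty x
      simp only [t, Set.mem_iInter, not_forall] at hxt
      obtain ⟨n, hn, hxn⟩ := hxt
      refine Set.mem_iUnion₂.2 ⟨n, hn, ?_, hxn⟩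
      have hnN : n ≤ N := Nat.lt_succ_iff.1 (Finset.mem_range.1 hn)
      exact Set.mem_iUnion₂.2 ⟨N, Finset.mem_Icc.2 ⟨hnN, le_max_left _ _⟩, hxN⟩
    have h1 : ν (B N) ≤ ∑ n ∈ Finset.range (N + 1), (ν (C n m') - ν (C n (m n))) := by
      refine le_of_tendsto_of_tendsto' (hν (B N))
        (tendsto_finsetSum _ fun n _ => (hν (C n m')).sub (hν (C n (m n)))) fun k => ?_
      have := hμ k
      refine (measureReal_mono hsub (measure_ne_top _ _)).trans ((measureReal_biUnion_finset_le _ _).trans ?_)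
      refine Finset.sum_le_sum fun n hn => le_of_eq ?_
      exact measureReal_sdiff (hCmono n ((Finset.le_sup hn).trans (le_max_right _ _)))
        (hC n (m n)).2.measurableSet (measure_ne_top _ _)
    have h2 : ∑ n ∈ Finset.range (N + 1), (ν (C n m') - ν (C n (m n))) ≤
        ∑ n ∈ Finset.range (N + 1), δ / 4 * (1 / 2) ^ n := by
      refine Finset.sum_le_sum fun n _ => ?_
      have h := hm n m'
      have e : δ / 2 ^ (n + 2) = δ / 4 * (1 / 2) ^ n := by
        rw [pow_add, one_div, inv_pow]; field_simp; norm_num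
      linarith
    have h3 : ∑ n ∈ Finset.range (N + 1), ((1 : ℝ) / 2) ^ n ≤ 2 := sum_geometric_two_le _
    rw [← Finset.mul_sum] at h2
    have := hνB N
    nlinarith
  have htcl : ∀ N, IsClosed (t N) := fun N => isClosed_biInter fun n _ => (hC n _).1
  -- A common point lies in some `B i` with `i ≥ n` for every `n`, against `hx`.
  obtain ⟨x, hxt⟩ := IsCompact.nonempty_iInter_of_sequence_nonempty_isCompact_isClosed t
    (fun N => Set.biInter_subset_biInter_left fun i hi => by
      have := Finset.mem_range.1 hi
      exact Finset.mem_range.2 (by omega)) htne (htcl 0).isCompact htcl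
  obtain ⟨n, hn⟩ := eventually_atTop.1 (hx x)
  have hxn : x ∈ C n (m n) :=
    Set.mem_iInter₂.1 (Set.mem_iInter.1 hxt n) n (Finset.self_mem_range_succ n)
  obtain ⟨i, hi, hxi⟩ := Set.mem_iUnion₂.1 hxn
  exact hn i (Finset.mem_Icc.1 hi).1 hxi

/-! ### Towers: tiles, heights and multiplicity -/

section Towers

variable {G : Type*} [TopologicalSpace G] [ArrowGroupoid G]

namespace IsMultisection

variable {ι : Type*} {C : ι → ι → Set G}

theorem s_mem (hC : IsMultisection C) {i j : ι} {x : G} (hx : x ∈ C i j) : s x ∈ C j j := by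
  rw [← hC.mul i j j] at hx
  obtain ⟨y, -, z, hz, h, rfl⟩ := mem_setMul.1 hx
  rwa [s_mul h, s_of_mem_units (hC.level_subset j hz)]

theorem r_mem (hC : IsMultisection C) {i j : ι} {x : G} (hx : x ∈ C i j) : r x ∈ C i i := by
  rw [← hC.mul i i j] at hx
  obtain ⟨y, hy, z, -, h, rfl⟩ := mem_setMul.1 hx
  rwa [r_mul h, r_of_mem_units (hC.level_subset i hy)]

theorem exists_s_eq (hC : IsMultisection C) {j : ι} {u : G} (hu : u ∈ C j j) (i : ι) :
    ∃ x ∈ C i j, s x = u := by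
  have hs := s_of_mem_units (hC.level_subset j hu)
  rw [← hC.mul j i j] at hu
  obtain ⟨y, -, z, hz, h, rfl⟩ := mem_setMul.1 hu
  exact ⟨z, hz, by rw [← hs, s_mul h]⟩

theorem eq_of_r_eq (hC : IsMultisection C) {i i' j : ι} {x x' : G} (hx : x ∈ C i j)
    (hx' : x' ∈ C i' j) (h : r x = r x') : i = i' ∧ x = x' := by
  have hi : i = i' := by
    by_contra hne
    exact Set.disjoint_left.1 (hC.level_disjoint i i' hne) (hC.r_mem hx) (h ▸ hC.r_mem hx')
  subst hi
  exact ⟨rfl, (hC.bisection i j).injOn_r hx hx' h⟩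

end IsMultisection

namespace TowerSystem

variable (T : TowerSystem G)

/-- The base of the `l`-th tower. -/
def baseLevel (l : Fin T.m) : Set G := T.C l (T.base l) (T.base l)

theorem isCompactOpen_carrier : IsCompactOpen T.carrier :=
  IsCompactOpen.iUnion fun l => IsCompactOpen.iUnion fun _ => ⟨T.isCompact l _ _, T.isOpen l _ _⟩

theorem isCompactOpen_baseLevel (l : Fin T.m) : IsCompactOpen (T.baseLevel l) :=
  ⟨T.isCompact l _ _, T.isOpen l _ _⟩

theorem exists_mem_baseLevel {c : G} (hc : c ∈ units G) : ∃ l, c ∈ T.baseLevel l := by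
  rw [← T.iUnion_base] at hc
  exact Set.mem_iUnion.1 hc

theorem eq_of_mem_baseLevel {c : G} {l l' : Fin T.m} (hl : c ∈ T.baseLevel l)
    (hl' : c ∈ T.baseLevel l') : l = l' := by
  by_contra hne
  exact Set.disjoint_left.1 (T.base_disjoint l l' hne) hl hl'

theorem exists_mem_C {x : G} {l : Fin T.m} (hx : x ∈ T.carrier) (hl : s x ∈ T.baseLevel l) :
    ∃ i, x ∈ T.C l i (T.base l) := by
  obtain ⟨l', h⟩ := Set.mem_iUnion.1 hx
  obtain ⟨i, hi⟩ := Set.mem_iUnion.1 h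
  obtain rfl := T.eq_of_mem_baseLevel hl ((T.multisection l').s_mem hi)
  exact ⟨i, hi⟩

/-- Levels are disjoint within one tower, but levels of different towers may overlap. This is why
tiles are later added one tower at a time. -/
theorem injOn_r (l : Fin T.m) :
    Set.InjOn (r : G → G) {x | x ∈ T.carrier ∧ s x ∈ T.baseLevel l} := by
  rintro x ⟨hx, hxl⟩ x' ⟨hx', hxl'⟩ h
  obtain ⟨i, hi⟩ := T.exists_mem_C hx hxl
  obtain ⟨i', hi'⟩ := T.exists_mem_C hx' hxl'
  exact ((T.multisection l).eq_of_r_eq hi hi' h).2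

theorem ncard_fiber_carrier {c : G} {l : Fin T.m} (hc : c ∈ T.baseLevel l) :
    (fiber T.carrier c).ncard = T.size l := by
  choose x hx hs using fun i => (T.multisection l).exists_s_eq hc i
  have hinj : Function.Injective x := fun i i' h =>
    ((T.multisection l).eq_of_r_eq (hx i) (hx i') (congrArg r h)).1
  have hrange : fiber T.carrier c = Set.range x := by
    ext y
    constructor
    · rintro ⟨hy, rfl⟩
      obtain ⟨i, hi⟩ := T.exists_mem_C hy hc
      exact ⟨i, ((T.multisection l).bisection i _).injOn_s (hx i) hi (hs i)⟩
    · rintro ⟨i, rfl⟩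
      exact ⟨Set.mem_iUnion.2 ⟨l, Set.mem_iUnion.2 ⟨i, hx i⟩⟩, hs i⟩
  rw [hrange, ← Set.image_univ, Set.ncard_image_of_injective _ hinj, Set.ncard_univ, Nat.card_fin]

theorem size_pos (l : Fin T.m) : 0 < T.size l := (T.base l).pos

theorem size_eq_height (hT : T.HasControlledHeight 1) (l : Fin T.m) : T.size l = T.height :=
  le_antisymm (by simpa using hT l) (ciInf_le (OrderBot.bddBelow _) l)

theorem ncard_fiber_eq_height (hT : T.HasControlledHeight 1) {c : G} (hc : c ∈ units G) :
    (fiber T.carrier c).ncard = T.height := by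
  obtain ⟨l, hl⟩ := T.exists_mem_baseLevel hc
  rw [T.ncard_fiber_carrier hl, T.size_eq_height hT]

theorem height_pos (hT : T.HasControlledHeight 1) (hne : (units G).Nonempty) : 0 < T.height := by
  obtain ⟨c, hc⟩ := hne
  obtain ⟨l, -⟩ := T.exists_mem_baseLevel hc
  rw [← T.size_eq_height hT l]
  exact T.size_pos l

/-- If the levels over `L` of each height are `M`-colorable, then every unit lies in the range of
at most `T.height * M` arrows of the towers over `L`. -/
theorem ncard_rangeFiber_le (hT : T.HasControlledHeight 1) {M : ℕ}
    {f : ∀ l : Fin T.m, Fin T.height → Fin (T.size l)} (hf : ∀ l, Function.Injective (f l))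
    {L : Finset (Fin T.m)}
    (hL : ∀ k : Fin T.height, AtMostColorable M (fun l : L => T.C l (f l k) (f l k))) (u : G) :
    (rangeFiber {x | x ∈ T.carrier ∧ s x ∈ ⋃ l ∈ L, T.baseLevel l} u).ncard ≤ T.height * M := by
  choose col hcol using hL
  -- Controlled height makes all towers equally tall, so the injections enumerate every level and
  -- the colorings see every arrow.
  have hsurj : ∀ l, Function.Surjective (f l) := fun l =>
    ((Fintype.bijective_iff_injective_and_card (f l)).2
      ⟨hf l, by simp [T.size_eq_height hT l]⟩).2
  have hex : ∀ x : rangeFiber {x | x ∈ T.carrier ∧ s x ∈ ⋃ l ∈ L, T.baseLevel l} u,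
      ∃ (k : Fin T.height) (l : L), x.1 ∈ T.C l (f l k) (T.base l) := by
    rintro ⟨x, ⟨hx, hxL⟩, -⟩
    obtain ⟨l, hl, hxl⟩ := Set.mem_iUnion₂.1 hxL
    obtain ⟨i, hi⟩ := T.exists_mem_C hx hxl
    obtain ⟨k, rfl⟩ := hsurj l i
    exact ⟨k, ⟨l, hl⟩, hi⟩
  choose k l hkl using hex
  -- An arrow into `u` is determined by its height and color: levels of equal height and color that
  -- share `u` belong to the same tower, and `r` is injective on each bisection of that tower.
  have hinj : Function.Injective fun x => (k x, col (k x) (l x)) := by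
    intro x y hxy
    obtain ⟨h1, h2⟩ := Prod.mk.inj hxy
    have hr : r x.1 = r y.1 := x.2.2.trans y.2.2.symm
    have hxl := hkl x
    have hyl := hkl y
    rw [← h1] at hyl h2
    have hll : l x = l y := by
      by_contra hne
      exact Set.disjoint_left.1 (hcol (k x) _ _ hne h2) ((T.multisection _).r_mem hxl)
        (hr ▸ (T.multisection _).r_mem hyl)
    rw [← hll] at hyl
    exact Subtype.ext ((T.multisection _).bisection _ _ |>.injOn_r hxl hyl hr)
  have hcard := Nat.card_le_card_of_injective _ hinj
  rwa [Nat.card_prod, Nat.card_fin, Nat.card_fin] at hcard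

end TowerSystem

end Towers

/-! ### Tilings and their extension -/

section Tilings

variable {G : Type*} [TopologicalSpace G] [ArrowGroupoid G]

/-- A compact open set `Z` on which `r` is injective, seen as the family of tiles `r (Z c)`: up to
the proportions `δ` and `η`, the `K`-translates of each tile stay in `r Z`, and in the tile. -/
structure IsTiling (K Z : Set G) (δ η : ℝ) : Prop where
  isCompactOpen : IsCompactOpen Z
  injOn : Set.InjOn (r : G → G) Z
  exterior : ∀ c ∈ units G,
    ({w | w ∈ setMul K (fiber Z c) ∧ r w ∉ r '' Z}.ncard : ℝ) ≤ δ * (fiber Z c).ncard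
  outer : ∀ c ∈ units G,
    ((outerBoundary K (fiber Z c)).ncard : ℝ) ≤ η * (fiber Z c).ncard

theorem IsTiling.empty (K : Set G) (δ η : ℝ) : IsTiling K ∅ δ η := by
  have h (c : G) : fiber (∅ : Set G) c = ∅ := Set.eq_empty_of_forall_notMem fun x hx => hx.1
  have h' : setMul K (∅ : Set G) = ∅ :=
    Set.eq_empty_of_forall_notMem fun z ⟨_, _, _, hy, _⟩ => hy
  refine ⟨IsCompactOpen.empty, Set.injOn_empty _, fun c _ => ?_, fun c _ => ?_⟩
  · simp [h, h']
  · simp [h, h', outerBoundary]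

variable [IsAmple G] [T2Space G]

theorem IsTiling.mono {K K' Z : Set G} {δ η : ℝ} (hZ : IsTiling K' Z δ η) (hK' : IsCompactOpen K')
    (h : K ⊆ K') : IsTiling K Z δ η := by
  have hfin (c : G) : (setMul K' (fiber Z c)).Finite := by
    rw [setMul_fiber]; exact (hK'.setMul hZ.isCompactOpen).finite_fiber c
  refine ⟨hZ.isCompactOpen, hZ.injOn, fun c hc => le_trans ?_ (hZ.exterior c hc),
    fun c hc => le_trans ?_ (hZ.outer c hc)⟩
  · exact Nat.cast_le.2 (Set.ncard_le_ncard (fun w hw => ⟨setMul_mono h le_rfl hw.1, hw.2⟩)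
      ((hfin c).subset fun w hw => hw.1))
  · exact Nat.cast_le.2 (Set.ncard_le_ncard (fun w hw => ⟨setMul_mono h le_rfl hw.1, hw.2⟩)
      ((hfin c).subset fun w hw => hw.1))

/-- Given disjoint tiles `r (S c)`, `c ∈ P₀`, add to a tiling the uncovered part of each tile that
is `(K, δ)`-invariant and covered up to a proportion at most `α`. -/
theorem IsTiling.exists_extension {K Z S P₀ : Set G} {δ δ' η α : ℝ} (hZ : IsTiling K Z δ' η)
    (hK : IsCompactOpen K) (hS : IsCompactOpen S) (hP₀ : IsCompactOpen P₀)
    (hinj : Set.InjOn (r : G → G) {x | x ∈ S ∧ s x ∈ P₀})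
    (hδ : 0 ≤ δ) (hα : 0 ≤ α) (hα' : α ≤ 1 / 2) (hδ' : 2 * δ ≤ δ') (hη : 2 * (δ + α) ≤ η) :
    ∃ Z', Z ⊆ Z' ∧ IsTiling K Z' δ' η ∧ ∀ c ∈ P₀,
      ((outerBoundary K (fiber S c)).ncard : ℝ) ≤ δ * (fiber S c).ncard →
      α * (fiber S c).ncard ≤ ({y | y ∈ fiber S c ∧ r y ∈ r '' Z'}.ncard : ℝ) := by
  have hZc := hZ.isCompactOpen
  set F : Set G := {y | y ∈ S ∧ r y ∉ r '' Z} with hFdef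
  have hF : IsCompactOpen F := hS.sep_r_notMem hZc.image_r
  have hFS : F ⊆ S := fun y hy => hy.1
  have hOB : IsCompactOpen (outerBoundary K S) := (hK.setMul hS).diff hS
  -- The base points whose tile is invariant and still uncovered up to the proportion `α`. A new
  -- piece with the same base point as an old tile is merged with it; the bounds survive because
  -- boundaries of unions are subadditive.
  set P : Set G := {c | c ∈ P₀ ∧ (((outerBoundary K (fiber S c)).ncard : ℝ) ≤
    δ * (fiber S c).ncard ∧ (1 - α) * (fiber S c).ncard ≤ (fiber F c).ncard)} with hPdef
  have hP : IsCompactOpen P := by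
    have h := hP₀.sep ((hOB.isLocallyConstant_ncard_fiber).prodMk
      (hS.isLocallyConstant_ncard_fiber.prodMk hF.isLocallyConstant_ncard_fiber))
      (fun q : ℕ × ℕ × ℕ => (q.1 : ℝ) ≤ δ * q.2.1 ∧ (1 - α) * q.2.1 ≤ q.2.2)
    simpa only [← outerBoundary_fiber] using h
  set A : Set G := {y | y ∈ F ∧ s y ∈ P} with hAdef
  have hA : IsCompactOpen A := hF.sep_s_mem hP
  have hdisj : Disjoint Z A := Set.disjoint_left.2 fun y hy hyA => hyA.1.2 ⟨y, hy, rfl⟩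
  have hAP : ∀ c ∈ P, fiber A c = fiber F c := fun c hc => by
    ext y
    exact ⟨fun h => ⟨h.1.1, h.2⟩, fun h => ⟨⟨h.1, h.2 ▸ hc⟩, h.2⟩⟩
  have hAP' : ∀ c, c ∉ P → fiber A c = ∅ := fun c hc =>
    Set.eq_empty_of_forall_notMem fun y hy => hc (hy.2 ▸ hy.1.2)
  have hcard := fun c => ncard_fiber_union hZc hA hdisj c
  have hrZ : r '' Z ⊆ r '' (Z ∪ A) := Set.image_mono Set.subset_union_left
  have hcov : ∀ c ∈ P, ∀ y ∈ fiber S c, r y ∈ r '' (Z ∪ A) := fun c hc y hy => by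
    by_cases h : r y ∈ r '' Z
    · exact hrZ h
    · exact ⟨y, Or.inr ⟨⟨hy.1, h⟩, hy.2 ▸ hc⟩, rfl⟩
  have hfinK {B : Set G} (hB : IsCompactOpen B) (c : G) : (setMul K (fiber B c)).Finite := by
    rw [setMul_fiber]; exact (hK.setMul hB).finite_fiber c
  -- Since `α ≤ 1 / 2`, bounds relative to the whole tile become bounds relative to the added piece
  -- at the cost of the factor 2 in `hδ'` and `hη`.
  have hhalf : ∀ c ∈ P, ((fiber S c).ncard : ℝ) ≤ 2 * (fiber A c).ncard := fun c hc => by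
    rw [hAP c hc]
    have h := hc.2.2
    have h0 : (0 : ℝ) ≤ (fiber S c).ncard := Nat.cast_nonneg _
    nlinarith
  have hsplit : ∀ c, (fiber F c).ncard + (fiber S c \ fiber F c).ncard = (fiber S c).ncard :=
    fun c => by
      rw [add_comm, Set.ncard_sdiff_add_ncard_of_subset (fiber_mono hFS c) (hS.finite_fiber c)]
  refine ⟨Z ∪ A, Set.subset_union_left, ⟨hZc.union hA, ?_, ?_, ?_⟩, ?_⟩
  · rintro x (hx | hx) y (hy | hy) h
    · exact hZ.injOn hx hy h
    · exact absurd ⟨x, hx, h⟩ hy.1.2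
    · exact absurd ⟨y, hy, h.symm⟩ hx.1.2
    · exact hinj ⟨hx.1.1, hx.2.1⟩ ⟨hy.1.1, hy.2.1⟩ h
  · intro c hc
    have hZ' := hZ.exterior c hc
    by_cases hcP : c ∈ P
    -- After the extension the whole tile is covered, so a translate leaving the covered set must
    -- leave the tile. Hence `α` does not enter the exterior bound, which can be far smaller than
    -- `η`.
    · have hsub : {w | w ∈ setMul K (fiber (Z ∪ A) c) ∧ r w ∉ r '' (Z ∪ A)} ⊆
          {w | w ∈ setMul K (fiber Z c) ∧ r w ∉ r '' Z} ∪ outerBoundary K (fiber S c) := by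
        rintro w ⟨hw, hrw⟩
        rw [fiber_union, setMul_union_right] at hw
        rcases hw with hw | hw
        · exact Or.inl ⟨hw, fun h => hrw (hrZ h)⟩
        · exact Or.inr ⟨setMul_mono le_rfl (fiber_mono (fun y hy => hy.1.1) c) hw,
            fun h => hrw (hcov c hcP w h)⟩
      have h1 : ({w | w ∈ setMul K (fiber (Z ∪ A) c) ∧ r w ∉ r '' (Z ∪ A)}.ncard : ℝ) ≤
          {w | w ∈ setMul K (fiber Z c) ∧ r w ∉ r '' Z}.ncard +
            (outerBoundary K (fiber S c)).ncard := by
        exact_mod_cast (Set.ncard_le_ncard hsub (((hfinK hZc c).subset fun w hw => hw.1).union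
          ((hfinK hS c).subset fun w hw => hw.1))).trans (Set.ncard_union_le _ _)
      have h2 := hcP.2.1
      have h3 := hhalf c hcP
      have h4 : (0 : ℝ) ≤ (fiber A c).ncard := Nat.cast_nonneg _
      rw [hcard]; push_cast
      nlinarith
    · have h0 := hAP' c hcP
      have h1 : (fiber (Z ∪ A) c) = fiber Z c := by rw [fiber_union, h0, Set.union_empty]
      rw [h1]
      refine le_trans ?_ hZ'
      exact Nat.cast_le.2 (Set.ncard_le_ncard (fun w hw => ⟨hw.1, fun h => hw.2 (hrZ h)⟩)
        ((hfinK hZc c).subset fun w hw => hw.1))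
  · intro c hc
    have hZ' := hZ.outer c hc
    by_cases hcP : c ∈ P
    -- A translate of the added piece may also land in the part of the tile that was already
    -- covered, of proportion at most `α`.
    · have hsub : outerBoundary K (fiber (Z ∪ A) c) ⊆
          outerBoundary K (fiber Z c) ∪
            (outerBoundary K (fiber S c) ∪ (fiber S c \ fiber F c)) := by
        rintro w ⟨hw, hw'⟩
        rw [fiber_union, setMul_union_right] at hw
        rw [fiber_union] at hw'
        rcases hw with hw | hw
        · exact Or.inl ⟨hw, fun h => hw' (Or.inl h)⟩
        · by_cases hwS : w ∈ fiber S c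
          · exact Or.inr (Or.inr ⟨hwS, fun h => hw' (Or.inr (by rwa [hAP c hcP]))⟩)
          · exact Or.inr (Or.inl ⟨setMul_mono le_rfl (fiber_mono (fun y hy => hy.1.1) c) hw, hwS⟩)
      have h1 : ((outerBoundary K (fiber (Z ∪ A) c)).ncard : ℝ) ≤
          (outerBoundary K (fiber Z c)).ncard +
            ((outerBoundary K (fiber S c)).ncard + (fiber S c \ fiber F c).ncard) := by
        exact_mod_cast (Set.ncard_le_ncard hsub (((hfinK hZc c).subset fun w hw => hw.1).union
          (((hfinK hS c).subset fun w hw => hw.1).union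
            ((hS.finite_fiber c).subset fun w hw => hw.1)))).trans
          ((Set.ncard_union_le _ _).trans (Nat.add_le_add_left (Set.ncard_union_le _ _) _))
      have h2 := hcP.2.1
      have h2' := hcP.2.2
      have h3 := hhalf c hcP
      have h4 : (0 : ℝ) ≤ (fiber A c).ncard := Nat.cast_nonneg _
      have h5 : ((fiber F c).ncard : ℝ) + (fiber S c \ fiber F c).ncard = (fiber S c).ncard := by
        exact_mod_cast hsplit c
      have h6 : (δ + α) * (fiber S c).ncard ≤ (δ + α) * (2 * (fiber A c).ncard) :=
        mul_le_mul_of_nonneg_left h3 (by linarith)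
      have h7 : 2 * (δ + α) * (fiber A c).ncard ≤ η * (fiber A c).ncard :=
        mul_le_mul_of_nonneg_right hη h4
      rw [hcard]; push_cast
      linarith
    · have h0 := hAP' c hcP
      have h1 : (fiber (Z ∪ A) c) = fiber Z c := by rw [fiber_union, h0, Set.union_empty]
      rwa [h1]
  · intro c hc hgood
    have h0 : (0 : ℝ) ≤ (fiber S c).ncard := Nat.cast_nonneg _
    by_cases hcP : c ∈ P
    · have : {y | y ∈ fiber S c ∧ r y ∈ r '' (Z ∪ A)} = fiber S c :=
        Set.Subset.antisymm (fun y hy => hy.1) fun y hy => ⟨hy, hcov c hcP y hy⟩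
      rw [this]
      nlinarith
    -- An invariant tile that was not selected already had more than the proportion `α` covered.
    · have h1 : ((fiber F c).ncard : ℝ) < (1 - α) * (fiber S c).ncard := by
        by_contra! h
        exact hcP ⟨hc, hgood, h⟩
      have h2 : (fiber S c \ fiber F c).ncard ≤
          {y | y ∈ fiber S c ∧ r y ∈ r '' (Z ∪ A)}.ncard := by
        refine Set.ncard_le_ncard (fun y hy => ⟨hy.1, hrZ ?_⟩)
          ((hS.finite_fiber c).subset fun y hy => hy.1)
        by_contra h
        exact hy.2 ⟨⟨hy.1.1, h⟩, hy.1.2⟩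
      have h3 := hsplit c
      have h2' : ((fiber S c \ fiber F c).ncard : ℝ) ≤
          {y | y ∈ fiber S c ∧ r y ∈ r '' (Z ∪ A)}.ncard := by exact_mod_cast h2
      have h3' : ((fiber F c).ncard : ℝ) + (fiber S c \ fiber F c).ncard = (fiber S c).ncard := by
        exact_mod_cast h3
      linarith

theorem ncard_covered_mono {S Z Z' : Set G} (hS : IsCompactOpen S) (h : Z ⊆ Z') (c : G) :
    ({y | y ∈ fiber S c ∧ r y ∈ r '' Z}.ncard : ℝ) ≤
      {y | y ∈ fiber S c ∧ r y ∈ r '' Z'}.ncard := by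
  exact Nat.cast_le.2 (Set.ncard_le_ncard (fun y hy => ⟨hy.1, Set.image_mono h hy.2⟩)
    ((hS.finite_fiber c).subset fun y hy => hy.1))

/-- A tiling can be extended so that every `(K, δ)`-invariant tile of finitely many given tower
systems is covered up to a proportion of at least `α`. -/
theorem IsTiling.exists_extension_towers {K Z : Set G} {δ δ' η α : ℝ} (hZ : IsTiling K Z δ' η)
    (hK : IsCompactOpen K) (S : ℕ → TowerSystem G) (E : Finset ℕ)
    (hδ : 0 ≤ δ) (hα : 0 ≤ α) (hα' : α ≤ 1 / 2) (hδ' : 2 * δ ≤ δ') (hη : 2 * (δ + α) ≤ η) :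
    ∃ Z', Z ⊆ Z' ∧ IsTiling K Z' δ' η ∧ ∀ n ∈ E, ∀ c ∈ units G,
      ((outerBoundary K (fiber (S n).carrier c)).ncard : ℝ) ≤
        δ * (fiber (S n).carrier c).ncard →
      α * (fiber (S n).carrier c).ncard ≤
        ({y | y ∈ fiber (S n).carrier c ∧ r y ∈ r '' Z'}.ncard : ℝ) := by
  classical
  have hone : ∀ (T : TowerSystem G) (t : Finset (Fin T.m)) (Z : Set G), IsTiling K Z δ' η →
      ∃ Z', Z ⊆ Z' ∧ IsTiling K Z' δ' η ∧ ∀ l ∈ t, ∀ c ∈ T.baseLevel l,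
        ((outerBoundary K (fiber T.carrier c)).ncard : ℝ) ≤ δ * (fiber T.carrier c).ncard →
        α * (fiber T.carrier c).ncard ≤
          ({y | y ∈ fiber T.carrier c ∧ r y ∈ r '' Z'}.ncard : ℝ) := by
    intro T t Z hZ
    induction t using Finset.induction_on with
    | empty => exact ⟨Z, le_rfl, hZ, by simp⟩
    | insert l t _ ih =>
      obtain ⟨Z₁, hZZ₁, hZ₁, hc₁⟩ := ih
      obtain ⟨Z₂, hZZ₂, hZ₂, hc₂⟩ := hZ₁.exists_extension hK T.isCompactOpen_carrier
        (T.isCompactOpen_baseLevel l) (T.injOn_r l) hδ hα hα' hδ' hη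
      refine ⟨Z₂, hZZ₁.trans hZZ₂, hZ₂, fun l' hl' c hc hgood => ?_⟩
      rcases Finset.mem_insert.1 hl' with rfl | hl'
      · exact hc₂ c hc hgood
      · exact (hc₁ l' hl' c hc hgood).trans
          (ncard_covered_mono T.isCompactOpen_carrier hZZ₂ c)
  induction E using Finset.induction_on with
  | empty => exact ⟨Z, le_rfl, hZ, by simp⟩
  | insert n E _ ih =>
    obtain ⟨Z₁, hZZ₁, hZ₁, hc₁⟩ := ih
    obtain ⟨Z₂, hZZ₂, hZ₂, hc₂⟩ := hone (S n) Finset.univ Z₁ hZ₁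
    refine ⟨Z₂, hZZ₁.trans hZZ₂, hZ₂, fun n' hn' c hc hgood => ?_⟩
    rcases Finset.mem_insert.1 hn' with rfl | hn'
    · obtain ⟨l, hl⟩ := (S n').exists_mem_baseLevel hc
      exact hc₂ l (Finset.mem_univ l) c hl hgood
    · exact (hc₁ n' hn' c hc hgood).trans
        (ncard_covered_mono (S n').isCompactOpen_carrier hZZ₂ c)

end Tilings

/-! ### The elementary groupoid of a tiling -/

section Elementary

variable {G : Type*} [ArrowGroupoid G]

/-- The arrows between points of the same tile. -/
def tileGroupoid (Z : Set G) : Set G := setMul Z (inv '' Z)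

theorem mem_tileGroupoid {Z : Set G} {x : G} :
    x ∈ tileGroupoid Z ↔ ∃ a ∈ Z, ∃ b ∈ Z, s a = s b ∧ mul a (inv b) = x := by
  rw [tileGroupoid, mem_setMul]
  constructor
  · rintro ⟨a, ha, _, ⟨b, hb, rfl⟩, h, rfl⟩
    exact ⟨a, ha, b, hb, by rw [h, r_inv], rfl⟩
  · rintro ⟨a, ha, b, hb, h, rfl⟩
    exact ⟨a, ha, inv b, ⟨b, hb, rfl⟩, by rw [h, r_inv], rfl⟩

theorem tileGroupoid_inter_units {Z : Set G} : tileGroupoid Z ∩ units G = r '' Z := by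
  ext x
  constructor
  · rintro ⟨hx, hu⟩
    obtain ⟨a, ha, b, hb, h, rfl⟩ := mem_tileGroupoid.1 hx
    exact ⟨a, ha, by rw [← r_of_mem_units hu, r_mul (by rw [h, r_inv])]⟩
  · rintro ⟨a, ha, rfl⟩
    exact ⟨mem_tileGroupoid.2 ⟨a, ha, a, ha, rfl, mul_inv_self a⟩, r_mem_units a⟩

theorem fiber_tileGroupoid {Z : Set G} (hZ : Set.InjOn (r : G → G) Z) {b : G} (hb : b ∈ Z) :
    fiber (tileGroupoid Z) (r b) = (fun x => mul x (inv b)) '' fiber Z (s b) := by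
  ext x
  constructor
  · rintro ⟨hx, hs⟩
    obtain ⟨a, ha, b', hb', h, rfl⟩ := mem_tileGroupoid.1 hx
    rw [s_mul (by rw [h, r_inv]), s_inv] at hs
    obtain rfl := hZ hb' hb hs
    exact ⟨a, ⟨ha, h⟩, rfl⟩
  · rintro ⟨a, ⟨ha, h⟩, rfl⟩
    exact ⟨mem_tileGroupoid.2 ⟨a, ha, b, hb, h, rfl⟩, by
      simp only [s_mul (show s a = r (inv b) by rw [h, r_inv]), s_inv]⟩

/-- Right translation by `inv b` carries the fiber of `Z` onto the fiber of the groupoid and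
commutes with left multiplication by `K`. -/
theorem outerBoundary_fiber_tileGroupoid_subset {K Z : Set G} (hZ : Set.InjOn (r : G → G) Z)
    {b : G} (hb : b ∈ Z) :
    outerBoundary K (fiber (tileGroupoid Z) (r b)) ⊆
      (fun x => mul x (inv b)) '' outerBoundary K (fiber Z (s b)) := by
  rw [fiber_tileGroupoid hZ hb]
  rintro w ⟨hw, hw'⟩
  obtain ⟨y, hy, _, ⟨a, ha, rfl⟩, h, rfl⟩ := mem_setMul.1 hw
  have hab : s a = r (inv b) := by rw [ha.2, r_inv]
  have hya : s y = r a := by rw [h]; exact r_mul hab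
  have e : mul y (mul a (inv b)) = mul (mul y a) (inv b) := (mul_assoc' hya hab).symm
  refine ⟨mul y a, ⟨mul_mem_setMul hy ha hya, fun hmem => hw' ?_⟩, e.symm⟩
  exact ⟨mul y a, hmem, e.symm⟩

variable [TopologicalSpace G] [IsAmple G] [T2Space G]

/-- Everything rests on injectivity of `r` on `Z`: composability of `a b⁻¹` with `a' b'⁻¹` forces `b
= a'`, and an isotropy arrow `a b⁻¹` has `a = b`. -/
theorem IsTiling.isElementarySubgroupoid {K Z : Set G} {δ η : ℝ} (hZ : IsTiling K Z δ η) :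
    IsElementarySubgroupoid (tileGroupoid Z) := by
  have hco := hZ.isCompactOpen.setMul hZ.isCompactOpen.image_inv
  refine ⟨hco.1, hco.2, ?_, ?_, ?_⟩
  · intro x hx y hy hxy
    rw [← mul_eq_comp]
    obtain ⟨a, ha, b, hb, h, rfl⟩ := mem_tileGroupoid.1 hx
    obtain ⟨a', ha', b', hb', h', rfl⟩ := mem_tileGroupoid.1 hy
    have hab : s a = r (inv b) := by rw [h, r_inv]
    have hab' : s a' = r (inv b') := by rw [h', r_inv]
    rw [s_mul hab, s_inv, r_mul hab'] at hxy
    obtain rfl := hZ.injOn hb ha' hxy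
    refine mem_tileGroupoid.2 ⟨a, ha, b', hb', h.trans h', ?_⟩
    rw [← mul_assoc' (by rw [s_mul hab, s_inv]) hab', inv_mul_cancel_right' h]
  · intro x hx
    obtain ⟨a, ha, b, hb, h, rfl⟩ := mem_tileGroupoid.1 hx
    refine mem_tileGroupoid.2 ⟨b, hb, a, ha, h.symm, ?_⟩
    have hab : s a = r (inv b) := by rw [h, r_inv]
    have e := mul_inv_cancel_right' (x := inv (mul a (inv b))) (y := a)
      (by rw [s_inv, r_mul hab])
    rw [← e]
    congr 1
    have e2 := inv_mul_cancel_left' (x := mul a (inv b)) (y := b) (by rw [s_mul hab, s_inv])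
    rwa [inv_mul_cancel_right' h, eq_comm] at e2
  · intro x hx hsr
    obtain ⟨a, ha, b, hb, h, rfl⟩ := mem_tileGroupoid.1 hx
    have hab : s a = r (inv b) := by rw [h, r_inv]
    rw [s_mul hab, s_inv, r_mul hab] at hsr
    obtain rfl := hZ.injOn hb ha hsr
    rw [mul_inv_self]
    exact r_mem_units b

theorem IsTiling.outerBoundary_tileGroupoid {K K' Z : Set G} {δ η ε : ℝ}
    (hZ : IsTiling K' Z δ η) (hK' : IsCompactOpen K') (hK : K ⊆ K') (hη : η < ε) {u : G}
    (hu : u ∈ tileGroupoid Z ∩ units G) :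
    (outerBoundary K (fiber (tileGroupoid Z) u)).Finite ∧
      ((outerBoundary K (fiber (tileGroupoid Z) u)).ncard : ℝ) <
        ε * (fiber (tileGroupoid Z) u).ncard := by
  rw [tileGroupoid_inter_units] at hu
  obtain ⟨b, hb, rfl⟩ := hu
  have hfin : (outerBoundary K' (fiber Z (s b))).Finite := by
    rw [outerBoundary_fiber]
    exact ((hK'.setMul hZ.isCompactOpen).diff hZ.isCompactOpen).finite_fiber _
  have hsub : outerBoundary K (fiber (tileGroupoid Z) (r b)) ⊆
      (fun x => mul x (inv b)) '' outerBoundary K' (fiber Z (s b)) :=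
    (outerBoundary_fiber_tileGroupoid_subset hZ.injOn hb).trans
      (Set.image_mono fun w hw => ⟨setMul_mono hK le_rfl hw.1, hw.2⟩)
  refine ⟨(hfin.image _).subset hsub, ?_⟩
  have h1 : (outerBoundary K (fiber (tileGroupoid Z) (r b))).ncard ≤
      (outerBoundary K' (fiber Z (s b))).ncard :=
    (Set.ncard_le_ncard hsub (hfin.image _)).trans (Set.ncard_image_le hfin)
  have h2 : (fiber (tileGroupoid Z) (r b)).ncard = (fiber Z (s b)).ncard := by
    rw [fiber_tileGroupoid hZ.injOn hb]
    exact Set.InjOn.ncard_image ((mul_right_injOn (inv b)).mono fun x hx => by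
      change s x = r (inv b)
      rw [hx.2, r_inv])
  have h3 := hZ.outer (s b) (s_mem_units b)
  have h4 : 0 < (fiber Z (s b)).ncard :=
    (Set.ncard_pos (hZ.isCompactOpen.finite_fiber _)).2 ⟨b, hb, rfl⟩
  have h5 : (0 : ℝ) < (fiber Z (s b)).ncard := by exact_mod_cast h4
  have h6 : ((outerBoundary K (fiber (tileGroupoid Z) (r b))).ncard : ℝ) ≤
      (outerBoundary K' (fiber Z (s b))).ncard := by exact_mod_cast h1
  rw [h2]
  nlinarith

end Elementary

/-! ### Measure gained by covering -/

section Gain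

variable {G : Type*} [TopologicalSpace G] [ArrowGroupoid G] [IsAmple G] [T2Space G]
  [MeasurableSpace G] [BorelSpace G]

/-- If every tile `r (S c)` with `c ∈ Q` is covered by `r Z₁` up to a proportion of at least `α`,
and `r Z₀` is nearly invariant under `S⁻¹`, then `r Z₁` covers a definite proportion of the
complement of `r Z₀`. -/
theorem covering_gain {T : TowerSystem G} (hT : T.HasControlledHeight 1) {M : ℕ} {ε : ℝ}
    (hgood : T.IsGood M ε) {K K₁ Z₀ Z₁ Q : Set G} {δ η δ₁ η₁ α κ : ℝ}
    (hZ₀ : IsTiling K Z₀ δ η) (hK : IsCompactOpen K) (hSK : inv '' T.carrier ⊆ K)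
    (hZ₁ : IsTiling K₁ Z₁ δ₁ η₁) (hZ : Z₀ ⊆ Z₁) (hδ : 0 ≤ δ) (hα : 0 ≤ α)
    (hQ : IsCompactOpen Q)
    (hcov : ∀ c ∈ Q, α * (fiber T.carrier c).ncard ≤
      ({y | y ∈ fiber T.carrier c ∧ r y ∈ r '' Z₁}.ncard : ℝ))
    {μ : Measure (units G)} (hμ : μ ∈ invariantMeasures G)
    (hμQ : 1 - κ ≤ μ.real (Subtype.val ⁻¹' Q)) :
    α * (1 - μ.real (Subtype.val ⁻¹' (r '' Z₀)) - κ - ε) ≤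
      δ + M * (μ.real (Subtype.val ⁻¹' (r '' Z₁)) - μ.real (Subtype.val ⁻¹' (r '' Z₀))) := by
  have hprob := hμ.1
  obtain ⟨f, hf, -, -, L, ⟨c₀, hc₀, hL⟩, hcol⟩ := hgood
  have hBL : 1 - ε ≤ μ.real (Subtype.val ⁻¹' ⋃ l ∈ L, T.baseLevel l) := hc₀.le.trans (hL μ hμ)
  have hne : (units G).Nonempty := by
    by_contra hne
    rw [Set.not_nonempty_iff_eq_empty] at hne
    have : IsEmpty (units G) := Set.isEmpty_coe_sort.2 hne
    have h := measure_univ (μ := μ)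
    rw [Set.univ_eq_empty_iff.2 this, measure_empty] at h
    exact zero_ne_one h
  have hh : (0 : ℝ) < T.height := by exact_mod_cast T.height_pos hT hne
  have hS := T.isCompactOpen_carrier
  have hBLc : IsCompactOpen (⋃ l ∈ L, T.baseLevel l) :=
    IsCompactOpen.biUnion L fun l _ => T.isCompactOpen_baseLevel l
  have hR₀ := hZ₀.isCompactOpen.image_r
  have hR₁ := hZ₁.isCompactOpen.image_r
  have hR : r '' Z₀ ⊆ r '' Z₁ := Set.image_mono hZ
  -- There is an arrow of `D` into `c` exactly when `c` lies outside `r '' Z₀` while its tile meets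
  -- `r '' Z₀`.
  set D : Set G := {w | w ∈ setMul (inv '' T.carrier) Z₀ ∧ r w ∉ r '' Z₀} with hD
  have hDc : IsCompactOpen D := (hS.image_inv.setMul hZ₀.isCompactOpen).sep_r_notMem hR₀
  set A : Set G := {y | y ∈ {x | x ∈ T.carrier ∧ s x ∈ ⋃ l ∈ L, T.baseLevel l} ∧
    r y ∈ r '' Z₁ \ r '' Z₀} with hA
  have hAc : IsCompactOpen A := (hS.sep_s_mem hBLc).sep_r_mem (hR₁.diff hR₀)
  set P : Set G := (Q ∩ ⋃ l ∈ L, T.baseLevel l) \ r '' Z₀ with hP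
  have hPc : IsCompactOpen P := (hQ.inter hBLc).diff hR₀
  -- Either the tile of `c` meets the old range, and its size is bounded by the height times the
  -- number of arrows of `D` into `c`; or its covered part is entirely new and is counted by `A`.
  have hpt : ∀ c : units G, α * T.height * ((P.indicator (1 : G → ℕ) c : ℕ) : ℝ) ≤
      T.height * (rangeFiber D c).ncard + (fiber A c).ncard := by
    rintro ⟨c, hc⟩
    by_cases hcP : c ∈ P
    · rw [Set.indicator_of_mem hcP]
      obtain ⟨⟨hcQ, hcL⟩, hc₀⟩ := hcP
      have h1 := hcov c hcQ
      rw [T.ncard_fiber_eq_height hT hc] at h1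
      have hsub : {y | y ∈ fiber T.carrier c ∧ r y ∈ r '' Z₁} ⊆
          {y | y ∈ fiber T.carrier c ∧ r y ∈ r '' Z₀} ∪ fiber A c := by
        rintro y ⟨hy, hy1⟩
        by_cases hy0 : r y ∈ r '' Z₀
        · exact Or.inl ⟨hy, hy0⟩
        · exact Or.inr ⟨⟨⟨hy.1, by rw [hy.2]; exact hcL⟩, hy1, hy0⟩, hy.2⟩
      have hfin : {y | y ∈ fiber T.carrier c ∧ r y ∈ r '' Z₀}.Finite :=
        (hS.finite_fiber c).subset fun y hy => hy.1
      have h2 := (Set.ncard_le_ncard hsub (hfin.union (hAc.finite_fiber c))).trans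
        (Set.ncard_union_le _ _)
      have h3 : {y | y ∈ fiber T.carrier c ∧ r y ∈ r '' Z₀}.ncard ≤
          T.height * (rangeFiber D c).ncard := by
        rcases Set.eq_empty_or_nonempty {y | y ∈ fiber T.carrier c ∧ r y ∈ r '' Z₀} with
          he | ⟨y, hy, z, hz, hzy⟩
        · rw [he, Set.ncard_empty]; exact Nat.zero_le _
        · have hle : {y | y ∈ fiber T.carrier c ∧ r y ∈ r '' Z₀}.ncard ≤ T.height := by
            rw [← T.ncard_fiber_eq_height hT hc]
            exact Set.ncard_le_ncard (fun y hy => hy.1) (hS.finite_fiber c)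
          have hyz : s (inv y) = r z := by rw [s_inv, hzy]
          have hr : r (mul (inv y) z) = c := by rw [r_mul hyz, r_inv, hy.2]
          have hpos : 0 < (rangeFiber D c).ncard :=
            (Set.ncard_pos (hDc.finite_rangeFiber c)).2 ⟨mul (inv y) z,
              ⟨mul_mem_setMul ⟨y, hy.1, rfl⟩ hz hyz, by rw [hr]; exact hc₀⟩, hr⟩
          exact hle.trans (Nat.le_mul_of_pos_right _ hpos)
      have h4 : ({y | y ∈ fiber T.carrier c ∧ r y ∈ r '' Z₁}.ncard : ℝ) ≤
          T.height * (rangeFiber D c).ncard + (fiber A c).ncard := by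
        exact_mod_cast h2.trans (Nat.add_le_add_right h3 _)
      simpa using h1.trans h4
    · rw [Set.indicator_of_notMem hcP]
      simp only [Nat.cast_zero, mul_zero]
      positivity
  obtain ⟨hP1, hP2⟩ := integral_indicator_preimage hPc μ
  obtain ⟨hD1, hD2, hD3⟩ := mass_transport hDc hμ
  obtain ⟨hA1, hA2, hA3⟩ := mass_transport hAc hμ
  obtain ⟨hZ1, hZ2, hZ3⟩ := mass_transport hZ₀.isCompactOpen hμ
  obtain ⟨hN1, hN2⟩ := integral_indicator_preimage (hR₁.diff hR₀) μ
  have hI1 := integral_mono (hP1.const_mul (α * T.height))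
    ((hD2.const_mul (T.height : ℝ)).add hA1) hpt
  have hI2 : ∫ c : units G, (α * T.height * ((P.indicator (1 : G → ℕ) c : ℕ) : ℝ)) ∂μ =
      α * T.height * μ.real (Subtype.val ⁻¹' P) := by rw [integral_const_mul, hP2]
  have hI3 : ∫ c : units G, ((T.height : ℝ) * (rangeFiber D c).ncard + (fiber A c).ncard) ∂μ =
      T.height * ∫ c : units G, ((fiber D c).ncard : ℝ) ∂μ +
        ∫ c : units G, ((rangeFiber A c).ncard : ℝ) ∂μ := by
    rw [integral_add (hD2.const_mul _) hA1, integral_const_mul, hD3, hA3]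
  -- The exterior bound reduces this to `δ` times the mean fiber size of `Z₀`. By mass transport
  -- this mean is at most 1, since `r` is injective on `Z₀`.
  have hI4 : ∫ c : units G, ((fiber D c).ncard : ℝ) ∂μ ≤ δ := by
    have h1 : ∫ c : units G, ((fiber D c).ncard : ℝ) ∂μ ≤
        ∫ c : units G, δ * ((fiber Z₀ c).ncard : ℝ) ∂μ := by
      refine integral_mono hD1 (hZ1.const_mul δ) fun c => ?_
      refine le_trans ?_ (hZ₀.exterior c c.2)
      refine Nat.cast_le.2 (Set.ncard_le_ncard ?_ ?_)
      · rintro w ⟨⟨hw, hwr⟩, hws⟩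
        refine ⟨setMul_mono hSK le_rfl ?_, hwr⟩
        rw [setMul_fiber]
        exact ⟨hw, hws⟩
      · refine ((hK.setMul hZ₀.isCompactOpen).finite_fiber c).subset fun w hw => ?_
        rw [← setMul_fiber]
        exact hw.1
    have h2 : ∫ c : units G, ((rangeFiber Z₀ c).ncard : ℝ) ∂μ ≤ ∫ _ : units G, (1 : ℝ) ∂μ := by
      refine integral_mono hZ2 (integrable_const 1) fun c => ?_
      have : (rangeFiber Z₀ (c : G)).ncard ≤ 1 :=
        (Set.ncard_le_one (hZ₀.isCompactOpen.finite_rangeFiber _)).2 fun x hx y hy =>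
          hZ₀.injOn hx.1 hy.1 (hx.2.trans hy.2.symm)
      exact Nat.cast_le_one.2 this
    rw [integral_const_mul, hZ3] at h1
    have h3 : ∫ _ : units G, (1 : ℝ) ∂μ = 1 := by simp
    nlinarith
  -- Each newly covered point is hit by at most `T.height * M` arrows, by goodness; other points are
  -- not hit by `A`.
  have hI5 : ∫ c : units G, ((rangeFiber A c).ncard : ℝ) ∂μ ≤
      T.height * M * μ.real (Subtype.val ⁻¹' (r '' Z₁ \ r '' Z₀)) := by
    rw [← hN2, ← integral_const_mul]
    refine integral_mono hA2 (hN1.const_mul _) fun c => ?_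
    by_cases hc : (c : G) ∈ r '' Z₁ \ r '' Z₀
    · simp only [Set.indicator_of_mem hc, Pi.one_apply, Nat.cast_one, mul_one]
      have h1 := T.ncard_rangeFiber_le hT hf hcol c
      have hsub : rangeFiber A (c : G) ⊆
          rangeFiber {x | x ∈ T.carrier ∧ s x ∈ ⋃ l ∈ L, T.baseLevel l} c :=
        fun y hy => ⟨hy.1.1, hy.2⟩
      have h2 : (rangeFiber A (c : G)).ncard ≤ T.height * M :=
        (Set.ncard_le_ncard hsub ((hS.sep_s_mem hBLc).finite_rangeFiber c)).trans h1
      exact_mod_cast h2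
    · have : rangeFiber A (c : G) = ∅ := Set.eq_empty_of_forall_notMem fun y hy =>
        hc (by rw [← hy.2]; exact hy.1.2)
      simp [this, Set.indicator_of_notMem hc]
  have hN : μ.real (Subtype.val ⁻¹' (r '' Z₁ \ r '' Z₀)) =
      μ.real (Subtype.val ⁻¹' (r '' Z₁)) - μ.real (Subtype.val ⁻¹' (r '' Z₀)) := by
    rw [Set.preimage_sdiff]
    exact measureReal_sdiff (Set.preimage_mono hR) hR₀.measurableSet_preimage (measure_ne_top _ _)
  have hPm : 1 - μ.real (Subtype.val ⁻¹' (r '' Z₀)) - κ - ε ≤ μ.real (Subtype.val ⁻¹' P) := by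
    have hsub : (Set.univ : Set (units G)) ⊆ (Subtype.val ⁻¹' P ∪ Subtype.val ⁻¹' (r '' Z₀)) ∪
        ((Subtype.val ⁻¹' Q)ᶜ ∪ (Subtype.val ⁻¹' ⋃ l ∈ L, T.baseLevel l)ᶜ) := by
      intro c _
      simp only [hP, Set.mem_union, Set.mem_preimage, Set.mem_sdiff, Set.mem_inter_iff,
        Set.mem_compl_iff]
      tauto
    have h1 := measureReal_mono (μ := μ) hsub (measure_ne_top _ _)
    rw [probReal_univ] at h1
    have h2 := measureReal_union_le (μ := μ)
      (Subtype.val ⁻¹' P ∪ Subtype.val ⁻¹' (r '' Z₀) : Set (units G))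
      ((Subtype.val ⁻¹' Q)ᶜ ∪ (Subtype.val ⁻¹' ⋃ l ∈ L, T.baseLevel l)ᶜ)
    have h3 := measureReal_union_le (μ := μ)
      (Subtype.val ⁻¹' P : Set (units G)) (Subtype.val ⁻¹' (r '' Z₀))
    have h4 := measureReal_union_le (μ := μ)
      ((Subtype.val ⁻¹' Q)ᶜ : Set (units G)) ((Subtype.val ⁻¹' ⋃ l ∈ L, T.baseLevel l)ᶜ)
    rw [probReal_compl_eq_one_sub hQ.measurableSet_preimage,
      probReal_compl_eq_one_sub hBLc.measurableSet_preimage] at h4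
    linarith
  rw [hI2] at hI1
  have hI6 := hI1.trans hI3.le
  rw [hN] at hI5
  set X := μ.real (Subtype.val ⁻¹' P)
  have h7 : T.height * (α * X) ≤ T.height * (δ +
      M * (μ.real (Subtype.val ⁻¹' (r '' Z₁)) - μ.real (Subtype.val ⁻¹' (r '' Z₀)))) := by
    have := mul_le_mul_of_nonneg_left hI4 hh.le
    linarith
  exact (mul_le_mul_of_nonneg_left hPm hα).trans (le_of_mul_le_mul_left h7 hh)

end Gain

/-! ### Exhaustion of the unit space -/

section Exhaustion

variable {G : Type*} [TopologicalSpace G] [T2Space G] [MeasurableSpace G] [BorelSpace G]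
  [ArrowGroupoid G] [IsAmple G]

/-- Some initial segment of a Følner sequence contains, for each invariant measure, a set whose
tiles are `(K, δ)`-invariant over most units. -/
theorem IsFolnerSequence.exists_forall_measure_lt (hunits : IsCompact (units G))
    {S : ℕ → TowerSystem G} (hS : IsFolnerSequence S) {K : Set G} (hK : IsCompactOpen K)
    {δ κ : ℝ} (hδ : 0 < δ) (hκ : 0 < κ) (n₀ : ℕ) :
    ∃ N, ∀ μ ∈ invariantMeasures G, ∃ n < N, n₀ ≤ n ∧ ∃ Q, IsCompactOpen Q ∧ Q ⊆ units G ∧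
      (∀ c ∈ Q, ((outerBoundary K (fiber (S n).carrier c)).ncard : ℝ) ≤
        δ * (fiber (S n).carrier c).ncard) ∧
      1 - κ ≤ μ.real (Subtype.val ⁻¹' Q) := by
  let Q : ℕ → Set G := fun n => {c | c ∈ units G ∧
    ((outerBoundary K (fiber (S n).carrier c)).ncard : ℝ) ≤ δ * (fiber (S n).carrier c).ncard}
  have hQ : ∀ n, IsCompactOpen (Q n) := fun n => by
    have hSn := (S n).isCompactOpen_carrier
    have hOB : IsCompactOpen (outerBoundary K (S n).carrier) := (hK.setMul hSn).diff hSn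
    have h := (show IsCompactOpen (units G) from ⟨hunits, isOpen_units⟩).sep
      ((hOB.isLocallyConstant_ncard_fiber).prodMk hSn.isLocallyConstant_ncard_fiber)
      (fun q : ℕ × ℕ => (q.1 : ℝ) ≤ δ * q.2)
    simpa only [← outerBoundary_fiber] using h
  have hcpt : CompactSpace (units G) := isCompact_iff_compactSpace.1 hunits
  -- The shift by `n₀` discards the early Følner sets, whose goodness parameter may be too large.
  have hev : ∀ c : units G, ∀ᶠ n in atTop, c ∉ (Subtype.val ⁻¹' Q (n₀ + n) : Set (units G))ᶜ := by
    rintro ⟨c, hc⟩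
    have h := (hS.2 K hK.1 c hc).eventually_lt_const hδ
    have h' := (tendsto_add_atTop_nat n₀).eventually h
    filter_upwards [h'] with n hn
    rw [Set.notMem_compl_iff]
    refine ⟨hc, ?_⟩
    rw [add_comm n₀ n]
    obtain ⟨l, hl⟩ := (S (n + n₀)).exists_mem_baseLevel hc
    have hpos : (0 : ℝ) < (fiber (S (n + n₀)).carrier c).ncard := by
      rw [(S (n + n₀)).ncard_fiber_carrier hl]
      exact_mod_cast (S (n + n₀)).size_pos l
    exact ((div_lt_iff₀ hpos).1 hn).le
  obtain ⟨N, hN⟩ := exists_forall_measureReal_lt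
    (fun n => ((hQ (n₀ + n)).isClopen.preimage continuous_subtype_val).compl) hev hκ
  refine ⟨n₀ + N, fun μ hμ => ?_⟩
  have := hμ.1
  obtain ⟨n, hn, hlt⟩ := hN μ hμ.1
  rw [probReal_compl_eq_one_sub (hQ _).measurableSet_preimage] at hlt
  exact ⟨n₀ + n, by omega, by omega, Q (n₀ + n), hQ _, fun c hc => hc.1, fun c hc => hc.2,
    by linarith⟩

/-- Induction on the number of stages, for all `K` at once: the preceding tiling must be nearly
invariant also under the inverses of the Følner sets used next. Extension preserves both bounds
unchanged, so nothing deteriorates with `j`. -/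
theorem exists_isTiling (hunits : IsCompact (units G)) {M : ℕ} (hM : 0 < M) {ε : ℕ → ℝ}
    (hε_lim : Tendsto ε atTop (𝓝 0)) {S : ℕ → TowerSystem G} (hS : IsFolnerSequence S)
    (hgood : ∀ n, (S n).IsGood M (ε n)) (hheight : ∀ n, (S n).HasControlledHeight 1)
    {θ : ℝ} (hθ : 0 < θ) (hθ' : θ ≤ 1) (j : ℕ) {K : Set G} (hK : IsCompactOpen K) :
    ∃ Z, IsTiling K Z (θ ^ 2 / 32) (θ / 2) ∧ ∀ μ ∈ invariantMeasures G,
      1 - θ < μ.real (Subtype.val ⁻¹' (r '' Z)) ∨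
        j * (θ ^ 2 / (32 * M)) ≤ μ.real (Subtype.val ⁻¹' (r '' Z)) := by
  induction j generalizing K with
  | zero => exact ⟨∅, IsTiling.empty _ _ _, fun μ _ => Or.inr (by simp)⟩
  | succ j ih =>
    have hθ2 : 0 < θ ^ 2 := by positivity
    have hθ3 : θ ^ 2 ≤ θ := by nlinarith
    obtain ⟨n₀, hn₀⟩ := eventually_atTop.1
      (hε_lim.eventually_lt_const (show 0 < θ / 4 by positivity))
    -- The range of Følner sets depends only on `K` and is fixed before `Z₀`, so `Z₀` can be
    -- requested for the enlarged set. All `n < N` are handled together because the suitable `n`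
    -- depends on the measure.
    obtain ⟨N, hN⟩ := hS.exists_forall_measure_lt hunits hK
      (δ := θ ^ 2 / 64) (κ := θ / 4) (by positivity) (by positivity) n₀
    have hSinv : IsCompactOpen (⋃ n ∈ Finset.range N, inv '' (S n).carrier) :=
      IsCompactOpen.biUnion _ fun n _ => (S n).isCompactOpen_carrier.image_inv
    obtain ⟨Z₀, hZ₀, hμ₀⟩ := ih (hK.union hSinv)
    obtain ⟨Z₁, hZ, hZ₁, hcov⟩ := (hZ₀.mono (hK.union hSinv)
      Set.subset_union_left).exists_extension_towers hK S (Finset.range N) (δ := θ ^ 2 / 64)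
      (α := θ / 8) (by positivity) (by positivity) (by linarith) (by linarith) (by linarith)
    refine ⟨Z₁, hZ₁, fun μ hμ => ?_⟩
    have := hμ.1
    by_cases hbig : 1 - θ < μ.real (Subtype.val ⁻¹' (r '' Z₁))
    · exact Or.inl hbig
    right
    have hmono : μ.real (Subtype.val ⁻¹' (r '' Z₀)) ≤ μ.real (Subtype.val ⁻¹' (r '' Z₁)) :=
      measureReal_mono (Set.preimage_mono (Set.image_mono hZ)) (measure_ne_top _ _)
    have h₀ := (hμ₀ μ hμ).resolve_left fun h => hbig (h.trans_le hmono)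
    obtain ⟨n, hnN, hn, Q, hQ, hQu, hQn, hμQ⟩ := hN μ hμ
    have hnE : n ∈ Finset.range N := Finset.mem_range.2 hnN
    have hgain := covering_gain (hheight n) (hgood n) hZ₀ (hK.union hSinv)
      ((Set.subset_biUnion_of_mem (u := fun n => inv '' (S n).carrier) hnE).trans
        Set.subset_union_right) hZ₁ hZ (by positivity) (show 0 ≤ θ / 8 by positivity) hQ
      (fun c hc => hcov n hnE c (hQu hc) (hQn c hc)) hμ hμQ
    have hεn := hn₀ n hn
    set x := μ.real (Subtype.val ⁻¹' (r '' Z₀))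
    set y := μ.real (Subtype.val ⁻¹' (r '' Z₁))
    have hM' : (0 : ℝ) < M := by exact_mod_cast hM
    -- At least `θ` is uncovered and the exceptional sets cost `θ / 4` each, so the gross gain is `θ
    -- ^ 2 / 16`. The exterior bound `θ ^ 2 / 32` takes half of it, and the rest is divided by `M`.
    have h1 : θ / 8 * (θ / 2) ≤ θ / 8 * (1 - x - θ / 4 - ε n) :=
      mul_le_mul_of_nonneg_left (by linarith) (by positivity)
    have h2 : θ ^ 2 / (32 * M) ≤ y - x := by
      rw [div_le_iff₀ (by positivity)]
      nlinarith
    push_cast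
    linarith

end Exhaustion

end ArrowGroupoid

theorem theoremA {G : Type*} [TopologicalSpace G] [T2Space G] [LocallyCompactSpace G]
    [SigmaCompactSpace G] [MeasurableSpace G] [BorelSpace G]
    [ArrowGroupoid G] [ArrowGroupoid.IsAmple G]
    (hunits : IsCompact (ArrowGroupoid.units G))
    (M : ℕ) (hM : 0 < M) (ε : ℕ → ℝ) (hε_pos : ∀ n, 0 < ε n) (hε_anti : Antitone ε)
    (hε_lim : Tendsto ε atTop (𝓝 0))
    (S : ℕ → ArrowGroupoid.TowerSystem G) (hS : ArrowGroupoid.IsFolnerSequence S)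
    (hgood : ∀ n, (S n).IsGood M (ε n))
    (hheight : ∀ n, (S n).HasControlledHeight 1) :
    ArrowGroupoid.AlmostFiniteInMeasure G := by
  intro K hK θ hθ
  have hM' : (0 : ℝ) < M := by exact_mod_cast hM
  obtain ⟨K', hK', hKK'⟩ := ArrowGroupoid.exists_isCompactOpen_superset hK
  have hρ : 0 < min θ 1 := lt_min hθ one_pos
  have hρθ : min θ 1 ≤ θ := min_le_left _ _
  -- With this many stages the total gain would exceed 1, which excludes the second alternative of
  -- `exists_isTiling`.
  obtain ⟨j, hj⟩ := exists_nat_gt (1 / (min θ 1 ^ 2 / (32 * (M : ℝ))))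
  rw [div_lt_iff₀ (by positivity)] at hj
  obtain ⟨Z, hZ, hμ⟩ := ArrowGroupoid.exists_isTiling hunits hM hε_lim hS hgood hheight hρ
    (min_le_right _ _) j hK'
  refine ⟨ArrowGroupoid.tileGroupoid Z, hZ.isElementarySubgroupoid,
    fun u hu => hZ.outerBoundary_tileGroupoid hK' hKK' (by linarith) hu, fun μ hμM => ?_⟩
  have := hμM.1
  have hpre : (Subtype.val ⁻¹' ArrowGroupoid.tileGroupoid Z : Set (ArrowGroupoid.units G)) =
      Subtype.val ⁻¹' (ArrowGroupoid.r '' Z) := by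
    rw [← ArrowGroupoid.tileGroupoid_inter_units]
    ext u
    exact ⟨fun h => ⟨h, u.2⟩, fun h => h.1⟩
  rw [hpre]
  rcases hμ μ hμM with h | h
  · linarith
  · have := measureReal_le_one (μ := μ) (s := Subtype.val ⁻¹' (ArrowGroupoid.r '' Z))
    linarith
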